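/- All graphs are finite and simple. A cograph is a graph without an induced path on four vertices. For a graph $G$ and $i\in\mathbb N_0$ let $\mathscr S_i(G)$ be the largest $t\in\mathbb N_0$ with $K_{i,t}\subseteq G$, where $K_{0,t}$ is the empty graph on $t$ vertices, and $\mathscr S_i(G)=-\infty$ if there is no such $t$. A biclique-profile is a decreasing sequence $\mathscr P=(\mathscr P_i)_{i\ge 0}$ in $\mathbb N_0\cup\{\infty,-\infty\}$ that is subdiagonal: $\mathscr P_j<l$ implies $\mathscr P_l<j$ for all $j,l\in\mathbb N_0$. Its start-index is the least $i$ with $\mathscr P_i<\infty$. A graph $G$ fulfills $\mathscr P$ if $\mathscr S_i(G)\le\mathscr P_i$ for all $i$. A cograph is $\mathscr P$-extremal if it fulfills $\mathscr P$ and has the maximum number of edges among the cographs on the same number of vertices that fulfill $\mathscr P$; this maximum over cographs on $n$ vertices is denoted $\mathrm{ex}(n,\{\mathscr P,P_4\text{-ind}\})$. For a subgraph $H\subseteq G$ and $k\ge 0$, pumping $H$ in $G$ for $k$ times means replacing $H$ by $k+1$ disjoint copies of $H$ without edges between different copies, where each copy of a vertex $v$ of $H$ is joined to the neighbours of $v$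 outside $H$. A pumping core is a graph $G$ with a designated (non-empty) connected induced subgraph $H$, its pumping component, such that all vertices of $H$ have the same neighbourhood outside $H$. A family $(G_j,H_j)_{j\in\mathbb Z/R\mathbb Z}$ of pumping cores, with $R\ge 1$, is called a pumping family for $\mathscr P$ if for every sufficiently large $n$ some $\mathscr P$-extremal cograph on $n$ vertices is obtained by pumping $H_{n\bmod R}$ in $G_{n\bmod R}$ some number of times. Theorem (Pumping Theorem for biclique-profiles). Let $s,t\ge 1$ be integers. There is $N_{s,t}\in\mathbb N$ such that for every biclique-profile $\mathscr P$ with start-index $s$, start value $\mathscr P_s=t-1$ and non-negative limit there are $\alpha\in\mathbb Q_{\ge 0}$, an integer $R\ge 1$, a pumping family $(G_j,H_j)_{j\in\mathbb Z/R\mathbb Z}$ for $\mathscr P$ with $|G_j|\le N_{s,t}$ for all $j$, and constants $a_j\in\mathbb Q_{\le 0}$ ($j\in\mathbb Z/R\mathbb Z$) such that the following hold. 1. For all sufficiently large $n$, $\mathrm{ex}(n,\{\mathscr P,P_4\text{-ind}\})=a_{n\bmod R}+\alpha n$. 2. $\alpha\le s-1+\frac{t-1}{2}$. 3. If $s\ge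 2$, then $\mathrm{ex}(n,\{\mathscr P,P_4\text{-ind}\})<\left(s-1+\frac{t-1}{2}\right)n$ for every $n\ge 1$. 4. If $s\ge 2$ and in the above family, or in any other pumping family for $\mathscr P$ (with any period), some pumping component $H_q$ is a connected component of its core $G_q$, then $\alpha<s-1+\frac{t-1}{2}$. -/

import Mathlib

open Filter

/-- A cograph: a graph without an induced path on four vertices. -/
def IsCograph {V : Type*} (G : SimpleGraph V) : Prop :=
  ¬ (SimpleGraph.pathGraph 4).IsIndContained G

/-- The number of edges of a graph. -/
noncomputable def edgeCount {V : Type*} (G : SimpleGraph V) : ℕ :=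
  G.edgeSet.ncard

/-- The biclique-sequence of `G`: its value at `s` is the largest `t : ℕ` (zero included) such that
`G` contains the biclique `K_{s,t}` as a subgraph, and `-∞` (that is, `⊥`) if there is none.
Here `K_{0,t}` is the empty graph on `t` vertices. -/
noncomputable def bicliqueSeq {V : Type*} (G : SimpleGraph V) (s : ℕ) : WithBot ℕ∞ :=
  ⨆ (t : ℕ) (_ : (completeBipartiteGraph (Fin s) (Fin t)).IsContained G), ((t : ℕ∞) : WithBot ℕ∞)

/-- A biclique-profile: a decreasing subdiagonal sequence in `ℕ ∪ {∞, -∞}`. -/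
structure BicliqueProfile where
  /-- The underlying sequence. -/
  val : ℕ → WithBot ℕ∞
  antitone : Antitone val
  subdiagonal : ∀ j l : ℕ, val j < ((l : ℕ∞) : WithBot ℕ∞) → val l < ((j : ℕ∞) : WithBot ℕ∞)

namespace BicliqueProfile

/-- The limit of the (decreasing) sequence, that is, its infimum. -/
noncomputable def limit (P : BicliqueProfile) : WithBot ℕ∞ :=
  ⨅ i, P.val i

/-- `s` is the start-index of `P`: the minimal index at which the value is not `∞`. -/
def IsStartIndex (P : BicliqueProfile) (s : ℕ) : Prop :=
  IsLeast {i : ℕ | P.val i < ⊤} s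

/-- `G` fulfills `P`: its biclique-sequence is pointwise at most `P`. -/
def Fulfills {V : Type*} (P : BicliqueProfile) (G : SimpleGraph V) : Prop :=
  ∀ i, bicliqueSeq G i ≤ P.val i

/-- `G` is a `P`-extremal cograph: a cograph that fulfills `P` and has the maximal number of edges
among the cographs on the same number of vertices that fulfill `P`. -/
def IsExtremalCograph {V : Type*} (P : BicliqueProfile) (G : SimpleGraph V) : Prop :=
  IsCograph G ∧ P.Fulfills G ∧
    ∀ G' : SimpleGraph V, IsCograph G' → P.Fulfills G' → edgeCount G' ≤ edgeCount G

/-- The extremal function `ex(n, {P, P₄-ind})`: the maximal number of edges of a cograph on `n`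
vertices that fulfills `P`. -/
noncomputable def ex (P : BicliqueProfile) (n : ℕ) : ℕ :=
  sSup {m : ℕ | ∃ G : SimpleGraph (Fin n), IsCograph G ∧ P.Fulfills G ∧ edgeCount G = m}

end BicliqueProfile

/-- The vertices of the graph obtained by pumping `H` in `G` for `k` times: the vertices outside
`H`, and `k + 1` copies of every vertex of `H`. -/
abbrev PumpVertex {V : Type*} {G : SimpleGraph V} (H : G.Subgraph) (k : ℕ) : Type _ :=
  {v : V // v ∉ H.verts} ⊕ (H.verts × Fin (k + 1))

/-- The graph obtained by pumping `H` in `G` for `k` times: each of the `k + 1` disjoint copies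
of `H` is joined to the vertices outside `H` in the same way as `H` itself. -/
def pump {V : Type*} {G : SimpleGraph V} (H : G.Subgraph) (k : ℕ) :
    SimpleGraph (PumpVertex H k) where
  Adj x y := match x, y with
    | Sum.inl u, Sum.inl v => G.Adj u v
    | Sum.inl u, Sum.inr v => G.Adj u v.1
    | Sum.inr u, Sum.inl v => G.Adj u.1 v
    | Sum.inr u, Sum.inr v => u.2 = v.2 ∧ H.Adj u.1 v.1
  symm := ⟨by
    rintro (u | u) (v | v) h
    · exact h.symm
    · exact h.symm
    · exact h.symm
    · exact ⟨h.1.symm, h.2.symm⟩⟩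
  loopless := ⟨by
    rintro (u | u) h
    · exact G.loopless.irrefl _ h
    · exact H.loopless.irrefl _ h.2⟩

/-- A finite core graph with a designated pumping component: a connected induced subgraph all of
whose vertices have the same neighbours outside of it. -/
structure PumpingCore where
  /-- The number of vertices of the core graph. -/
  size : ℕ
  /-- The core graph. -/
  graph : SimpleGraph (Fin size)
  /-- The designated pumping component. -/
  comp : graph.Subgraph
  induced : comp.IsInduced
  connected : comp.Connected
  same_neighbours : ∀ v ∈ comp.verts, ∀ w ∈ comp.verts, ∀ u ∉ comp.verts,
    (graph.Adj v u ↔ graph.Adj w u)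

/-- The pumping component is a connected component of the whole core graph. -/
def PumpingCore.IsConnectedComponent (C : PumpingCore) : Prop :=
  ∃ c : C.graph.ConnectedComponent, c.supp = C.comp.verts

/-- For every large `n` there is a `P`-extremal cograph on `n` vertices that is obtained by pumping
the designated component of the core graph with index `n mod R`. -/
def IsPumpingFamily (P : BicliqueProfile) {R : ℕ} (C : ZMod R → PumpingCore) : Prop :=
  ∀ᶠ n : ℕ in atTop, ∃ k : ℕ,
    Nat.card (PumpVertex (C (n : ZMod R)).comp k) = n ∧
      P.IsExtremalCograph (pump (C (n : ZMod R)).comp k)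

/-! The engine is pumping. Since the profile is infinite below `s`, subdiagonality makes all its
values at least `s - 1`, so only bicliques with both sides of size at least `s` are constrained.
Hence admissible graphs are closed under disjoint union, `ex` is superadditive (`ex_add_le`), and a
connected module with fewer than `s` outside neighbours (a pump) may be repeated without losing
admissibility (`IsPump.good_pump`). Because `K_{s,t}` is excluded, descending through the join/union
decomposition of a large cograph yields many disjoint pumps of bounded size with a common
neighbourhood (`exists_pumps`).

Each new copy of a pump `H` adds `weight G H` to twice the edge number. The maximal ratio `p / h` of
weight to size among bounded pumps is the slope of `2 * ex`: pumping gives the lower bound, deleting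
pumps the upper one, and the error is bounded (`exists_hasSlope`). A large extremal graph must
contain a pump attaining this ratio, as deleting many worse pumps would contradict superadditivity.
In each residue class an extremal graph of least deficiency `p * n - h * (2 * ex n)`, pumped at such
a pump, keeps its deficiency and so stays extremal (`HasSlope.exists_core`).

The bounds on `α` come from an edge bound for `K_{s,t}`-free cographs (`adjCount_add_le`), and one
core size serves all profiles because only finitely many share `s` and `t` (`finite_admissible`). -/

/-! ### Elementary forms of the definitions -/

/-- A graph is a cograph iff it has no induced path `a b c d`. -/
theorem isCograph_iff {V : Type*} (G : SimpleGraph V) :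
    IsCograph G ↔ ∀ a b c d, G.Adj a b → G.Adj b c → G.Adj c d →
      ¬ G.Adj a c → ¬ G.Adj b d → ¬ G.Adj a d → False := by
  constructor
  · intro h a b c d hab hbc hcd hac hbd had
    have hac' : a ≠ c := by rintro rfl; exact had hcd
    have hbd' : b ≠ d := by rintro rfl; exact had hab
    have had' : a ≠ d := by rintro rfl; exact hac hcd.symm
    refine h ⟨⟨⟨![a, b, c, d], ?_⟩, ?_⟩⟩
    · intro i j hij
      fin_cases i <;> fin_cases j <;>
        simp_all [hab.ne, hbc.ne, hcd.ne, hab.ne', hbc.ne', hcd.ne', eq_comm]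
    · intro i j
      change G.Adj (![a, b, c, d] i) (![a, b, c, d] j) ↔ _
      rw [SimpleGraph.pathGraph_adj]
      fin_cases i <;> fin_cases j <;> simp_all [G.adj_comm]
  · rintro h ⟨f⟩
    have key : ∀ i j, G.Adj (f i) (f j) ↔ (SimpleGraph.pathGraph 4).Adj i j :=
      fun i j => f.map_adj_iff
    refine h (f 0) (f 1) (f 2) (f 3) ?_ ?_ ?_ ?_ ?_ ?_ <;> rw [key, SimpleGraph.pathGraph_adj] <;>
      simp

theorem fulfills_iff (P : BicliqueProfile) {V : Type*} (G : SimpleGraph V) :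
    P.Fulfills G ↔ ∀ S T : Finset V, (∀ x ∈ S, ∀ y ∈ T, G.Adj x y) →
      ((T.card : ℕ∞) : WithBot ℕ∞) ≤ P.val S.card := by
  simp only [BicliqueProfile.Fulfills, bicliqueSeq, iSup_le_iff]
  constructor
  · intro h S T hST
    refine h S.card T.card ?_
    rw [SimpleGraph.completeBipartiteGraph_isContained_iff]
    exact ⟨S, T, by simp, by simp, fun x hx y hy => hST x hx y hy⟩
  · intro h i j hij
    rw [SimpleGraph.completeBipartiteGraph_isContained_iff] at hij
    obtain ⟨S, T, hS, hT, hST⟩ := hij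
    have := h S T fun x hx y hy => hST hx hy
    simpa [hS, hT] using this

/-- A graph that is admissible for the extremal problem: a cograph that fulfills the profile. -/
def Good (P : BicliqueProfile) {V : Type*} (G : SimpleGraph V) : Prop :=
  IsCograph G ∧ P.Fulfills G

theorem Good.of_embedding {P : BicliqueProfile} {V W : Type*} {G : SimpleGraph V}
    {G' : SimpleGraph W} (h : Good P G') (f : G ↪g G') : Good P G := by
  refine ⟨fun h' => h.1 (h'.trans ⟨f⟩), ?_⟩
  rw [fulfills_iff]
  intro S T hST
  have := (fulfills_iff P G').1 h.2 (S.map f.toEmbedding) (T.map f.toEmbedding) (by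
    simp only [Finset.mem_map]
    rintro _ ⟨x, hx, rfl⟩ _ ⟨y, hy, rfl⟩
    exact f.map_adj_iff.2 (hST x hx y hy))
  simpa using this

/-- The properties of a profile with start-index `s`, start value `t - 1` and non-negative limit
that matter for the pumping theorem. -/
structure Admissible (P : BicliqueProfile) (s t : ℕ) : Prop where
  one_le_start : 1 ≤ s
  one_le_value : 1 ≤ t
  top_of_lt : ∀ i < s, P.val i = ⊤
  val_start : P.val s = (((t - 1 : ℕ) : ℕ∞) : WithBot ℕ∞)
  le_val : ∀ j < s, ∀ i, ((j : ℕ∞) : WithBot ℕ∞) ≤ P.val i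

theorem admissible_of_isStartIndex {P : BicliqueProfile} {s t : ℕ} (hs : 1 ≤ s) (ht : 1 ≤ t)
    (h : P.IsStartIndex s) (hv : P.val s = (((t - 1 : ℕ) : ℕ∞) : WithBot ℕ∞)) :
    Admissible P s t := by
  have htop : ∀ i < s, P.val i = ⊤ := by
    intro i hi
    by_contra hne
    exact absurd (h.2 (show i ∈ {i | P.val i < ⊤} from lt_top_iff_ne_top.2 hne)) (by omega)
  refine ⟨hs, ht, htop, hv, fun j hj i => ?_⟩
  -- A value below `j < s` at `i` would, by subdiagonality, make the infinite value at `j` smaller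
  -- than `i`.
  by_contra hlt
  have := P.subdiagonal i j (not_le.1 hlt)
  rw [htop j hj] at this
  exact absurd this not_top_lt

/-! ### Admissible graphs and disjoint unions -/

section Bounds

variable {P : BicliqueProfile} {s t : ℕ}

theorem Admissible.le_val_of_lt (hP : Admissible P s t) {m n : ℕ} (h : m < s ∨ n < s) :
    ((n : ℕ∞) : WithBot ℕ∞) ≤ P.val m := by
  rcases h with h | h
  · rw [hP.top_of_lt m h]; exact le_top
  · exact hP.le_val n h m

theorem Good.not_biclique (hP : Admissible P s t) {V : Type*} {G : SimpleGraph V}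
    (h : Good P G) (S T : Finset V) (hS : s ≤ S.card) (hT : t ≤ T.card) :
    ¬ ∀ x ∈ S, ∀ y ∈ T, G.Adj x y := by
  intro hST
  have h1 := (fulfills_iff P G).1 h.2 S T hST
  have h2 := h1.trans (P.antitone hS)
  rw [hP.val_start, WithBot.coe_le_coe, Nat.cast_le] at h2
  have := hP.one_le_value
  omega

theorem good_bot (hP : Admissible P s t) (V : Type*) : Good P (⊥ : SimpleGraph V) := by
  constructor
  · rw [isCograph_iff]; intro a b c d h; exact h.elim
  · rw [fulfills_iff]
    intro S T hST
    refine hP.le_val_of_lt ?_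
    have := hP.one_le_start
    rcases S.eq_empty_or_nonempty with rfl | ⟨x, hx⟩
    · left; simpa
    · rcases T.eq_empty_or_nonempty with rfl | ⟨y, hy⟩
      · right; simpa
      · exact (hST x hx y hy).elim

/-- A biclique with both sides non-empty is connected and so lies in one summand; an empty side is
unconstrained because `1 ≤ s`. -/
theorem Good.sum (hP : Admissible P s t) {V W : Type*} {G : SimpleGraph V} {G' : SimpleGraph W}
    (h : Good P G) (h' : Good P G') : Good P (G ⊕g G') := by
  constructor
  · have h1 := (isCograph_iff _).1 h.1
    have h2 := (isCograph_iff _).1 h'.1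
    rw [isCograph_iff]
    rintro (a | a) (b | b) (c | c) (d | d) hab hbc hcd <;> simp at hab hbc hcd ⊢
    · exact fun x y => not_not.1 (h1 a b c d hab hbc hcd x y)
    · exact fun x y => not_not.1 (h2 a b c d hab hbc hcd x y)
  · rw [fulfills_iff]
    intro S T hST
    have hs := hP.one_le_start
    rcases S.eq_empty_or_nonempty with rfl | ⟨x, hx⟩
    · exact hP.le_val_of_lt (Or.inl (by simpa))
    rcases T.eq_empty_or_nonempty with rfl | ⟨y, hy⟩
    · exact hP.le_val_of_lt (Or.inr (by simpa))
    have key : ∀ u ∈ S, ∀ v ∈ T, (u.isLeft ↔ v.isLeft) := by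
      intro u hu v hv
      have := hST u hu v hv
      rcases u with u | u <;> rcases v with v | v <;> simp at this ⊢
    rcases x with x | x
    · have hT : ∀ v ∈ T, v.isLeft := fun v hv => (key _ hx v hv).1 rfl
      have hS : ∀ v ∈ S, v.isLeft := fun v hv => (key v hv y hy).2 (hT y hy)
      have eS : S.toLeft.map .inl = S := by
        ext (u | u)
        · simp
        · simpa using fun hu => by simpa using hS _ hu
      have eT : T.toLeft.map .inl = T := by
        ext (u | u)
        · simp
        · simpa using fun hu => by simpa using hT _ hu
      have := (fulfills_iff P G).1 h.2 S.toLeft T.toLeft (by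
        intro u hu v hv
        simpa using hST (.inl u) (by simpa using hu) (.inl v) (by simpa using hv))
      rwa [← eS, ← eT, Finset.card_map, Finset.card_map]
    · have hT : ∀ v ∈ T, ¬ v.isLeft := fun v hv hl => by simpa using (key _ hx v hv).2 hl
      have hS : ∀ v ∈ S, ¬ v.isLeft := fun v hv hl => hT y hy ((key v hv y hy).1 hl)
      have eS : S.toRight.map .inr = S := by
        ext (u | u)
        · simpa using fun hu => by simpa using hS _ hu
        · simp
      have eT : T.toRight.map .inr = T := by
        ext (u | u)
        · simpa using fun hu => by simpa using hT _ hu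
        · simp
      have := (fulfills_iff P G').1 h'.2 S.toRight T.toRight (by
        intro u hu v hv
        simpa using hST (.inr u) (by simpa using hu) (.inr v) (by simpa using hv))
      rwa [← eS, ← eT, Finset.card_map, Finset.card_map]

end Bounds

/-! ### Counting ordered adjacent pairs -/

section AdjCount

variable {V : Type*} (G : SimpleGraph V)

open Classical in
/-- The number of pairs `(x, y) ∈ X × Y` of adjacent vertices. -/
noncomputable def adjCount (X Y : Finset V) : ℕ :=
  ∑ x ∈ X, ∑ y ∈ Y, if G.Adj x y then 1 else 0

theorem adjCount_comm (X Y : Finset V) : adjCount G X Y = adjCount G Y X := by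
  rw [adjCount, Finset.sum_comm]
  exact Finset.sum_congr rfl fun y _ => Finset.sum_congr rfl fun x _ => by rw [G.adj_comm]

theorem adjCount_union_left [DecidableEq V] {X X' : Finset V} (h : Disjoint X X') (Y : Finset V) :
    adjCount G (X ∪ X') Y = adjCount G X Y + adjCount G X' Y :=
  Finset.sum_union h

theorem adjCount_union_self [DecidableEq V] {X Y : Finset V} (h : Disjoint X Y) :
    adjCount G (X ∪ Y) (X ∪ Y) = adjCount G X X + adjCount G Y Y + 2 * adjCount G X Y := by
  rw [adjCount_union_left G h, adjCount_comm G X, adjCount_comm G Y, adjCount_union_left G h,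
    adjCount_union_left G h, adjCount_comm G Y X]
  ring

theorem adjCount_le (X Y : Finset V) : adjCount G X Y ≤ X.card * Y.card := by
  classical
  rw [adjCount, ← smul_eq_mul, ← Finset.sum_const]
  refine Finset.sum_le_sum fun x _ => ?_
  rw [← Finset.card_filter]
  exact Finset.card_filter_le _ _

theorem adjCount_eq_mul {X Y : Finset V} (h : ∀ x ∈ X, ∀ y ∈ Y, G.Adj x y) :
    adjCount G X Y = X.card * Y.card := by
  rw [adjCount, ← smul_eq_mul, ← Finset.sum_const]
  refine Finset.sum_congr rfl fun x hx => ?_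
  rw [Finset.card_eq_sum_ones]
  exact Finset.sum_congr rfl fun y hy => if_pos (h x hx y hy)

theorem adjCount_eq_zero {X Y : Finset V} (h : ∀ x ∈ X, ∀ y ∈ Y, ¬ G.Adj x y) :
    adjCount G X Y = 0 :=
  Finset.sum_eq_zero fun x hx => Finset.sum_eq_zero fun y hy => if_neg (h x hx y hy)

theorem adjCount_univ [Fintype V] :
    adjCount G Finset.univ Finset.univ = 2 * edgeCount G := by
  classical
  rw [edgeCount, ← SimpleGraph.coe_edgeFinset, Set.ncard_coe_finset,
    ← SimpleGraph.sum_degrees_eq_twice_card_edges]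
  refine Finset.sum_congr rfl fun x _ => ?_
  rw [← Finset.card_filter, ← SimpleGraph.card_neighborFinset_eq_degree,
    SimpleGraph.neighborFinset_eq_filter]

theorem adjCount_split [Fintype V] [DecidableEq V] (X : Finset V) :
    2 * edgeCount G = adjCount G Xᶜ Xᶜ + (adjCount G X X + 2 * adjCount G X Xᶜ) := by
  rw [← adjCount_univ, ← Finset.union_compl X, adjCount_union_self G disjoint_compl_right]
  ring

/-- The twofold number of edges that meet `X`. -/
noncomputable def weight [Fintype V] [DecidableEq V] (X : Finset V) : ℕ :=
  adjCount G X X + 2 * adjCount G X Xᶜ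

theorem two_mul_edgeCount_induce [Fintype V] (X : Finset V) :
    2 * edgeCount (G.induce (X : Set V)) = adjCount G X X := by
  classical
  rw [← adjCount_univ]
  simp only [adjCount, SimpleGraph.comap_adj, Function.Embedding.subtype_apply]
  rw [← Finset.sum_coe_sort X]
  refine Finset.sum_congr rfl fun x _ => ?_
  rw [← Finset.sum_coe_sort X]
  rfl

theorem edgeCount_sum [Fintype V] {W : Type*} [Fintype W] (G' : SimpleGraph W) :
    edgeCount (G ⊕g G') = edgeCount G + edgeCount G' := by
  classical
  have : 2 * edgeCount (G ⊕g G') = 2 * edgeCount G + 2 * edgeCount G' := by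
    simp only [← adjCount_univ, adjCount, Fintype.sum_sum_type]
    simp
  omega

theorem edgeCount_congr {W : Type*} {G' : SimpleGraph W} (e : G ≃g G') :
    edgeCount G = edgeCount G' :=
  Nat.card_congr e.mapEdgeSet

end AdjCount

/-! ### The extremal function and its superadditivity -/

section Ex

variable {P : BicliqueProfile} {s t : ℕ}

theorem two_mul_edgeCount_le {V : Type*} [Fintype V] (G : SimpleGraph V) :
    2 * edgeCount G ≤ Fintype.card V * Fintype.card V := by
  rw [← adjCount_univ]
  exact adjCount_le G _ _

theorem Good.edgeCount_le_ex {V : Type*} [Fintype V] {G : SimpleGraph V} (h : Good P G) :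
    edgeCount G ≤ P.ex (Fintype.card V) := by
  classical
  have e := G.overFinIso rfl
  refine le_csSup ⟨Fintype.card V * Fintype.card V, ?_⟩ ⟨_, (h.of_embedding e.symm.toEmbedding).1,
    (h.of_embedding e.symm.toEmbedding).2, (edgeCount_congr G e).symm⟩
  rintro m ⟨G', -, -, rfl⟩
  have := two_mul_edgeCount_le G'
  simp only [Fintype.card_fin] at this
  omega

theorem exists_good_edgeCount_eq_ex (hP : Admissible P s t) (n : ℕ) :
    ∃ G : SimpleGraph (Fin n), Good P G ∧ edgeCount G = P.ex n := by
  have := Nat.sSup_mem (s := {m : ℕ | ∃ G : SimpleGraph (Fin n), IsCograph G ∧ P.Fulfills G ∧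
    edgeCount G = m}) ⟨_, ⊥, (good_bot hP _).1, (good_bot hP _).2, rfl⟩ ⟨n * n, by
      rintro m ⟨G', -, -, rfl⟩
      have := two_mul_edgeCount_le G'
      simp only [Fintype.card_fin] at this
      omega⟩
  obtain ⟨G, h1, h2, h3⟩ := this
  exact ⟨G, ⟨h1, h2⟩, h3⟩

theorem isExtremalCograph_iff (hP : Admissible P s t) {V : Type*} [Fintype V]
    (G : SimpleGraph V) :
    P.IsExtremalCograph G ↔ Good P G ∧ edgeCount G = P.ex (Fintype.card V) := by
  constructor
  · rintro ⟨h1, h2, h3⟩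
    refine ⟨⟨h1, h2⟩, le_antisymm (Good.edgeCount_le_ex ⟨h1, h2⟩) ?_⟩
    obtain ⟨G', hG', he⟩ := exists_good_edgeCount_eq_ex hP (Fintype.card V)
    let φ := (Fintype.equivFin V)
    let e : G'.comap φ ≃g G' := SimpleGraph.Iso.comap φ G'
    have hg := hG'.of_embedding e.toEmbedding
    rw [← he, ← edgeCount_congr _ e]
    exact h3 _ hg.1 hg.2
  · rintro ⟨h1, h2⟩
    refine ⟨h1.1, h1.2, fun G' h h' => h2 ▸ Good.edgeCount_le_ex ⟨h, h'⟩⟩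

theorem ex_add_le (hP : Admissible P s t) (m n : ℕ) : P.ex m + P.ex n ≤ P.ex (m + n) := by
  obtain ⟨G, hG, he⟩ := exists_good_edgeCount_eq_ex hP m
  obtain ⟨G', hG', he'⟩ := exists_good_edgeCount_eq_ex hP n
  have := (hG.sum hP hG').edgeCount_le_ex
  rw [edgeCount_sum] at this
  simpa [he, he'] using this

theorem mul_ex_le (hP : Admissible P s t) (k n : ℕ) : k * P.ex n ≤ P.ex (k * n) := by
  induction k with
  | zero => simp
  | succ k ih =>
    have := ex_add_le hP (k * n) n
    rw [add_mul, one_mul, add_mul, one_mul]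
    omega

theorem ex_mono (hP : Admissible P s t) {m n : ℕ} (h : m ≤ n) : P.ex m ≤ P.ex n := by
  obtain ⟨k, rfl⟩ := Nat.exists_eq_add_of_le h
  have := ex_add_le hP m k
  omega

/-- Removing the vertices of `X` from an admissible graph. -/
theorem Good.two_mul_edgeCount_le_removal {V : Type*} [Fintype V] [DecidableEq V]
    {G : SimpleGraph V} (h : Good P G) (X : Finset V) :
    2 * edgeCount G ≤ 2 * P.ex (Fintype.card V - X.card) + weight G X := by
  have h1 := (h.of_embedding (SimpleGraph.Embedding.induce ((Xᶜ : Finset V) : Set V)))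
  have h2 := h1.edgeCount_le_ex
  have h3 := two_mul_edgeCount_induce G Xᶜ
  have h4 : Fintype.card ((Xᶜ : Finset V) : Set V) = Fintype.card V - X.card := by
    rw [← Finset.card_compl, ← Fintype.card_coe]; rfl
  rw [h4] at h2
  have := adjCount_split G X
  rw [weight]
  omega

end Ex

/-! ### Pumping preserves admissibility and adds a fixed weight -/

section Pump

variable {P : BicliqueProfile} {s t : ℕ} {V : Type*} {G : SimpleGraph V}

theorem pump_adj_proj {H : G.Subgraph} {k : ℕ} {x y : PumpVertex H k} (h : (pump H k).Adj x y) :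
    G.Adj (Sum.elim Subtype.val (fun p => p.1.1) x) (Sum.elim Subtype.val (fun p => p.1.1) y) := by
  rcases x with x | x <;> rcases y with y | y
  · exact h
  · exact h
  · exact h
  · exact H.adj_sub h.2

/-- The copies together form a module, and a path on four vertices has no proper module with at
least two vertices. So an induced path meets the copies in at most one vertex or lies inside them,
then in a single copy; either way it projects to an induced path of `G`. -/
theorem isCograph_pump {H : G.Subgraph} (hind : H.IsInduced)
    (hnbr : ∀ v ∈ H.verts, ∀ w ∈ H.verts, ∀ u ∉ H.verts, (G.Adj v u ↔ G.Adj w u))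
    (hG : IsCograph G) (k : ℕ) : IsCograph (pump H k) := by
  rw [isCograph_iff] at hG ⊢
  have hind' : ∀ u v : H.verts, H.Adj u v ↔ G.Adj u v :=
    fun u v => ⟨fun h => H.adj_sub h, fun h => hind u.2 v.2 h⟩
  have h1 : ∀ (u : {v // v ∉ H.verts}) (p q : H.verts × Fin (k + 1)),
      (pump H k).Adj (.inl u) (.inr p) → (pump H k).Adj (.inl u) (.inr q) := fun u p q h =>
    ((hnbr p.1 p.1.2 q.1 q.1.2 u.1 u.2).1 (G.symm.symm _ _ h)).symm
  have h2 : ∀ (u : {v // v ∉ H.verts}) (p q : H.verts × Fin (k + 1)),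
      (pump H k).Adj (.inr p) (.inl u) → (pump H k).Adj (.inr q) (.inl u) := fun u p q h =>
    (hnbr p.1 p.1.2 q.1 q.1.2 u.1 u.2).1 h
  rintro (a | a) (b | b) (c | c) (d | d) hab hbc hcd hac hbd had
  · exact hG a b c d hab hbc hcd hac hbd had
  · exact hG a b c d.1 hab hbc hcd hac hbd had
  · exact hG a b c.1 d hab hbc hcd hac hbd had
  · exact hbd (h1 b c d hbc)
  · exact hG a b.1 c d hab hbc hcd hac hbd had
  · exact had (h1 a b d hab)
  · exact hac (h1 a b c hab)
  · exact hac (h1 a b c hab)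
  · exact hG a.1 b c d hab hbc hcd hac hbd had
  · exact hac (h2 c d a ((pump H k).symm.symm _ _ hcd))
  · exact had (h2 d c a hcd)
  · exact hbd (h1 b a d ((pump H k).symm.symm _ _ hab))
  · exact hac (h2 c b a hbc)
  · exact hac (h2 c b a hbc)
  · exact hbd (h2 d c b hcd)
  · obtain ⟨i1, hab⟩ := hab
    obtain ⟨i2, hbc⟩ := hbc
    obtain ⟨i3, hcd⟩ := hcd
    refine hG a.1 b.1 c.1 d.1 (H.adj_sub hab) (H.adj_sub hbc) (H.adj_sub hcd)
      (fun h => hac ⟨by rw [i1, i2], (hind' _ _).2 h⟩)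
      (fun h => hbd ⟨by rw [i2, i3], (hind' _ _).2 h⟩)
      (fun h => had ⟨by rw [i1, i2, i3], (hind' _ _).2 h⟩)

/-- A constrained biclique has both sides larger than `A`. If one side meets a copy, the other lies
in that copy together with `A`, hence also meets the copy. So at most one copy is used, and the
biclique projects injectively into `G`. -/
theorem fulfills_pump (hP : Admissible P s t) {H : G.Subgraph} {A : Finset V} (hA : A.card < s)
    (hnbr : ∀ v ∈ H.verts, ∀ u ∉ H.verts, G.Adj v u → u ∈ A)
    (hG : P.Fulfills G) (k : ℕ) : P.Fulfills (pump H k) := by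
  classical
  rw [fulfills_iff] at hG ⊢
  intro S T hST
  by_cases hlt : S.card < s ∨ T.card < s
  · exact hP.le_val_of_lt hlt
  push Not at hlt
  have big : ∀ U : Finset (PumpVertex H k), s ≤ U.card →
      ∃ x ∈ U, ∀ u : {v // v ∉ H.verts}, u.1 ∈ A → x ≠ .inl u := by
    intro U hU
    by_contra! hcon
    have : (U.image (Sum.elim Subtype.val (fun p => p.1.1))).card ≤ A.card := by
      refine Finset.card_le_card fun v hv => ?_
      obtain ⟨x, hx, rfl⟩ := Finset.mem_image.1 hv
      obtain ⟨u, hu, rfl⟩ := hcon x hx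
      exact hu
    rw [Finset.card_image_of_injOn] at this
    · omega
    · intro x hx y hy hxy
      obtain ⟨u, hu, rfl⟩ := hcon x hx
      obtain ⟨v, hv, rfl⟩ := hcon y hy
      simpa [Subtype.ext_iff] using hxy
  have step : ∀ U W : Finset (PumpVertex H k), s ≤ W.card →
      (∀ x ∈ U, ∀ y ∈ W, (pump H k).Adj x y) → ∀ p, Sum.inr p ∈ U →
      (∀ q, Sum.inr q ∈ W → q.2 = p.2) ∧ ∃ q, Sum.inr q ∈ W := by
    intro U W hW hUW p hp
    refine ⟨fun q hq => (hUW _ hp _ hq).1.symm, ?_⟩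
    obtain ⟨y, hy, hyA⟩ := big W hW
    rcases y with y | y
    · exact absurd rfl (hyA y (hnbr p.1 p.1.2 y.1 y.2 (hUW _ hp _ hy)))
    · exact ⟨y, hy⟩
  have hTS : ∀ x ∈ T, ∀ y ∈ S, (pump H k).Adj x y := fun x hx y hy => (hST y hy x hx).symm
  have main : ∃ i, ∀ p, Sum.inr p ∈ S ∪ T → p.2 = i := by
    by_cases hS : ∃ p, Sum.inr p ∈ S
    · obtain ⟨p, hp⟩ := hS
      obtain ⟨h1, q, hq⟩ := step S T hlt.2 hST p hp
      obtain ⟨h2, -⟩ := step T S hlt.1 hTS q hq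
      refine ⟨p.2, fun r hr => ?_⟩
      rcases Finset.mem_union.1 hr with hr | hr
      · rw [h2 r hr, h1 q hq]
      · exact h1 r hr
    · by_cases hT : ∃ p, Sum.inr p ∈ T
      · obtain ⟨p, hp⟩ := hT
        exact absurd (step T S hlt.1 hTS p hp).2 hS
      · refine ⟨0, fun p hp => ?_⟩
        rcases Finset.mem_union.1 hp with hp | hp
        · exact absurd ⟨p, hp⟩ hS
        · exact absurd ⟨p, hp⟩ hT
  obtain ⟨i, hi⟩ := main
  let π : PumpVertex H k → V := Sum.elim Subtype.val (fun p => p.1.1)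
  have hinj : ∀ x ∈ S ∪ T, ∀ y ∈ S ∪ T, π x = π y → x = y := by
    rintro (x | x) hx (y | y) hy hxy
    · simpa [π, Subtype.ext_iff] using hxy
    · exact absurd y.1.2 (by have : x.1 = y.1.1 := hxy
                             rw [← this]; exact x.2)
    · exact absurd x.1.2 (by have : x.1.1 = y.1 := hxy
                             rw [this]; exact y.2)
    · exact congrArg Sum.inr (Prod.ext (Subtype.ext hxy) ((hi x hx).trans (hi y hy).symm))
  have := hG (S.image π) (T.image π) (by
    intro u hu v hv
    obtain ⟨x, hx, rfl⟩ := Finset.mem_image.1 hu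
    obtain ⟨y, hy, rfl⟩ := Finset.mem_image.1 hv
    exact pump_adj_proj (hST x hx y hy))
  rwa [Finset.card_image_of_injOn, Finset.card_image_of_injOn] at this
  · exact fun x hx y hy => hinj x (Finset.mem_union_left _ hx) y (Finset.mem_union_left _ hy)
  · exact fun x hx y hy => hinj x (Finset.mem_union_right _ hx) y (Finset.mem_union_right _ hy)

variable [Fintype V]

theorem card_pumpVertex [DecidableEq V] (H : G.Subgraph) {X : Finset V}
    (hX : ∀ v, v ∈ X ↔ v ∈ H.verts) (k : ℕ) :
    Nat.card (PumpVertex H k) = Xᶜ.card + (k + 1) * X.card := by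
  have h1 : Nat.card {v // v ∉ H.verts} = Xᶜ.card := by
    rw [Nat.subtype_card Xᶜ (by simp [hX])]
  have h2 : Nat.card H.verts = X.card := by
    exact Nat.subtype_card X hX
  rw [Nat.card_sum, Nat.card_prod, h1, h2, Nat.card_eq_fintype_card, Fintype.card_fin, mul_comm]

theorem two_mul_edgeCount_pump [DecidableEq V] {H : G.Subgraph} (hind : H.IsInduced)
    {X : Finset V} (hX : ∀ v, v ∈ X ↔ v ∈ H.verts) (k : ℕ) :
    2 * edgeCount (pump H k) = adjCount G Xᶜ Xᶜ +
      (k + 1) * weight G X := by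
  classical
  have hout : ∀ f : V → ℕ, ∑ u : {v // v ∉ H.verts}, f u = ∑ u ∈ Xᶜ, f u := by
    exact fun f => (Finset.sum_subtype _ (by simp [hX]) f).symm
  have hin : ∀ f : V → ℕ, ∑ u : H.verts, f u = ∑ u ∈ X, f u := by
    exact fun f => (Finset.sum_subtype _ (by simp [hX]) f).symm
  have h1 : adjCount G Xᶜ Xᶜ =
      ∑ u : {v // v ∉ H.verts}, ∑ v : {v // v ∉ H.verts}, if G.Adj u v then 1 else 0 := by
    rw [adjCount, ← hout]
    exact Finset.sum_congr rfl fun u _ => (hout _).symm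
  have h2 : adjCount G X X =
      ∑ u : H.verts, ∑ v : H.verts, if G.Adj u v then 1 else 0 := by
    rw [adjCount, ← hin]
    exact Finset.sum_congr rfl fun u _ => (hin _).symm
  have h3 : adjCount G X Xᶜ =
      ∑ u : H.verts, ∑ v : {v // v ∉ H.verts}, if G.Adj u v then 1 else 0 := by
    rw [adjCount, ← hin]
    exact Finset.sum_congr rfl fun u _ => (hout _).symm
  have h4 : adjCount G X Xᶜ =
      ∑ u : {v // v ∉ H.verts}, ∑ v : H.verts, if G.Adj u v then 1 else 0 := by
    rw [adjCount_comm, adjCount, ← hout]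
    exact Finset.sum_congr rfl fun u _ => (hin _).symm
  have h5 : ∀ u v : H.verts, H.Adj u v ↔ G.Adj u v :=
    fun u v => ⟨fun h => H.adj_sub h, fun h => hind u.2 v.2 h⟩
  have e1 : ∑ x : {v // v ∉ H.verts}, ∑ p : H.verts × Fin (k + 1),
      (if (pump H k).Adj (.inl x) (.inr p) then 1 else 0) =
        (k + 1) * adjCount G X Xᶜ := by
    rw [h4, Finset.mul_sum]
    refine Finset.sum_congr rfl fun x _ => ?_
    rw [Fintype.sum_prod_type, Finset.mul_sum]
    refine Finset.sum_congr rfl fun y _ => ?_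
    trans ∑ _i : Fin (k + 1), if G.Adj x y then 1 else 0
    · exact Finset.sum_congr rfl fun i _ => if_congr Iff.rfl rfl rfl
    · simp
  have e2 : ∑ p : H.verts × Fin (k + 1), ∑ x : {v // v ∉ H.verts},
      (if (pump H k).Adj (.inr p) (.inl x) then 1 else 0) =
        (k + 1) * adjCount G X Xᶜ := by
    rw [← e1, Finset.sum_comm]
    exact Finset.sum_congr rfl fun y _ => Finset.sum_congr rfl fun x _ => by
      rw [SimpleGraph.adj_comm]
  have e3 : ∑ p : H.verts × Fin (k + 1), ∑ q : H.verts × Fin (k + 1),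
      (if (pump H k).Adj (.inr p) (.inr q) then 1 else 0) =
        (k + 1) * adjCount G X X := by
    rw [h2, Finset.mul_sum, Fintype.sum_prod_type]
    refine Finset.sum_congr rfl fun x _ => ?_
    have : ∀ i : Fin (k + 1), ∑ q : H.verts × Fin (k + 1),
        (if (pump H k).Adj (.inr (x, i)) (.inr q) then 1 else 0) =
        ∑ y : H.verts, if G.Adj x y then 1 else 0 := by
      intro i
      rw [Fintype.sum_prod_type]
      refine Finset.sum_congr rfl fun y _ => ?_
      simp only [pump, h5]
      by_cases hxy : G.Adj x y <;> simp [hxy]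
    simp only [this]
    simp
  have e0 : ∑ x : {v // v ∉ H.verts}, ∑ y : {v // v ∉ H.verts},
      (if (pump H k).Adj (.inl x) (.inl y) then 1 else 0) =
        adjCount G Xᶜ Xᶜ := by
    rw [h1]
    exact Finset.sum_congr rfl fun x _ => Finset.sum_congr rfl fun y _ => if_congr Iff.rfl rfl rfl
  rw [← adjCount_univ, adjCount, Fintype.sum_sum_type]
  simp only [Fintype.sum_sum_type, Finset.sum_add_distrib]
  rw [e0, e1, e2, e3, weight]
  ring

end Pump

/-! ### Cographs split as a disjoint union or a join -/

section Split

variable {V : Type*} [DecidableEq V] {G : SimpleGraph V}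

/-- `W` is split into two non-empty parts, either with all or with no edges between them. -/
def IsSplit (G : SimpleGraph V) (W : Finset V) : Prop :=
  ∃ X Y : Finset V, X.Nonempty ∧ Y.Nonempty ∧ Disjoint X Y ∧ X ∪ Y = W ∧
    ((∀ x ∈ X, ∀ y ∈ Y, G.Adj x y) ∨ (∀ x ∈ X, ∀ y ∈ Y, ¬ G.Adj x y))

theorem isSplit_of_compl {W : Finset V} (h : IsSplit Gᶜ W) : IsSplit G W := by
  obtain ⟨X, Y, hX, hY, hd, hW, h | h⟩ := h
  · exact ⟨X, Y, hX, hY, hd, hW, Or.inr fun x hx y hy => ((SimpleGraph.compl_adj G x y).1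
      (h x hx y hy)).2⟩
  · refine ⟨X, Y, hX, hY, hd, hW, Or.inl fun x hx y hy => ?_⟩
    have := h x hx y hy
    rw [SimpleGraph.compl_adj, not_and, not_not] at this
    exact this (Finset.disjoint_iff_ne.1 hd x hx y hy)

theorem isCograph_compl {V : Type*} {G : SimpleGraph V} (h : IsCograph G) : IsCograph Gᶜ := by
  rw [isCograph_iff] at h ⊢
  intro a b c d hab hbc hcd hac hbd had
  have hac' : a ≠ c := by rintro rfl; exact had hcd
  have hbd' : b ≠ d := by rintro rfl; exact had hab
  have had' : a ≠ d := by rintro rfl; exact hac hcd.symm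
  simp only [SimpleGraph.compl_adj, not_and, not_not] at hab hbc hcd hac hbd had
  exact h b d a c (hbd hbd') (had had').symm (hac hac') (fun h => hab.2 h.symm)
    (fun h => hcd.2 h.symm) hbc.2

/-- The induction step for adding a vertex to a disconnected set; the case of a join follows by
passing to the complement. -/
theorem isSplit_insert (hG : IsCograph G) {X Y : Finset V} (hX : X.Nonempty) (hY : Y.Nonempty)
    (hd : Disjoint X Y) (hno : ∀ x ∈ X, ∀ y ∈ Y, ¬ G.Adj x y) {v : V} (hv : v ∉ X ∪ Y) :
    IsSplit G (insert v (X ∪ Y)) := by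
  classical
  rw [isCograph_iff] at hG
  rw [Finset.mem_union, not_or] at hv
  by_cases h1 : ∀ x ∈ X, ¬ G.Adj x v
  · refine ⟨X, insert v Y, hX, ⟨v, by simp⟩, by simp [hv.1, hd], by simp, Or.inr ?_⟩
    intro x hx y hy
    rcases Finset.mem_insert.1 hy with rfl | hy
    · exact h1 x hx
    · exact hno x hx y hy
  by_cases h2 : ∀ y ∈ Y, ¬ G.Adj y v
  · refine ⟨Y, insert v X, hY, ⟨v, by simp⟩, by simp [hv.2, hd.symm], ?_, Or.inr ?_⟩
    · rw [Finset.union_insert, Finset.union_comm]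
    intro x hx y hy
    rcases Finset.mem_insert.1 hy with rfl | hy
    · exact h2 x hx
    · exact fun h => hno y hy x hx h.symm
  by_cases h3 : ∀ x ∈ X ∪ Y, G.Adj v x
  · exact ⟨{v}, X ∪ Y, by simp, hX.mono Finset.subset_union_left, by simp [hv], by simp,
      Or.inl (by simpa using h3)⟩
  push Not at h1 h2 h3
  obtain ⟨x0, hx0, hx0v⟩ := h1
  obtain ⟨y0, hy0, hy0v⟩ := h2
  obtain ⟨u0, hu0, hu0v⟩ := h3
  -- Here `v` has neighbours on both sides. An edge from a neighbour `w` of `v` to a non-neighbour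
  -- `u` stays on one side, and a neighbour of `v` on the other side would start an induced path
  -- ending in `v`, `w`, `u`. So the non-neighbours of `v` are cut off.
  refine ⟨(X ∪ Y).filter (fun u => ¬ G.Adj v u), insert v ((X ∪ Y).filter fun u => G.Adj v u),
    ⟨u0, by simp [hu0v, Finset.mem_union.1 hu0]⟩, ⟨v, by simp⟩, ?_, ?_, Or.inr ?_⟩
  · rw [Finset.disjoint_left]
    intro u hu hu'
    simp only [Finset.mem_filter, Finset.mem_insert] at hu hu'
    rcases hu' with rfl | hu'
    · exact (not_or.2 hv) (Finset.mem_union.1 hu.1)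
    · exact hu.2 hu'.2
  · rw [Finset.union_insert, Finset.union_comm, Finset.filter_union_filter_not_eq]
  · intro u hu w hw huw
    simp only [Finset.mem_filter, Finset.mem_insert, Finset.mem_union] at hu hw
    rcases hw with rfl | ⟨hw, hvw⟩
    · exact hu.2 huw.symm
    rcases hu with ⟨hu | hu, hvu⟩ <;> rcases hw with hw | hw
    · exact hG y0 v w u hy0v hvw huw.symm (fun h => hno _ hw _ hy0 h.symm) hvu
        (fun h => hno _ hu _ hy0 h.symm)
    · exact hno u hu w hw huw
    · exact hno w hw u hu huw.symm
    · exact hG x0 v w u hx0v hvw huw.symm (hno _ hx0 _ hw) hvu (hno _ hx0 _ hu)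

/-- Every vertex set of size at least two of a cograph is disconnected or a join. -/
theorem isSplit_of_two_le (hG : IsCograph G) (W : Finset V) (hW : 2 ≤ W.card) : IsSplit G W := by
  induction W using Finset.induction_on with
  | empty => simp at hW
  | insert v W hv ih =>
    rw [Finset.card_insert_of_notMem hv] at hW
    by_cases h1 : W.card = 1
    · obtain ⟨w, rfl⟩ := Finset.card_eq_one.1 h1
      have hvw : v ≠ w := by simpa using hv
      refine ⟨{v}, {w}, by simp, by simp, by simpa using hvw, rfl, ?_⟩
      by_cases h : G.Adj v w
      · left; simpa using h
      · right; simpa using h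
    · obtain ⟨X, Y, hX, hY, hd, rfl, h | h⟩ := ih (by omega)
      · refine isSplit_of_compl (isSplit_insert (isCograph_compl hG) hX hY hd ?_ hv)
        intro x hx y hy h'
        exact ((SimpleGraph.compl_adj G x y).1 h').2 (h x hx y hy)
      · exact isSplit_insert hG hX hY hd h hv

end Split

/-! ### Edge bound for cographs without a given biclique -/

section Density

variable {V : Type*} {G : SimpleGraph V}

/-- There is no `K_{s,t}` inside of `W`. -/
def BicliqueFree (G : SimpleGraph V) (s t : ℕ) (W : Finset V) : Prop :=
  ∀ S T : Finset V, S ⊆ W → T ⊆ W → S.card = s → T.card = t → ¬ ∀ x ∈ S, ∀ y ∈ T, G.Adj x y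

theorem BicliqueFree.mono {s t : ℕ} {W W' : Finset V} (h : BicliqueFree G s t W) (hW : W' ⊆ W) :
    BicliqueFree G s t W' :=
  fun S T hS hT => h S T (hS.trans hW) (hT.trans hW)

theorem BicliqueFree.symm {s t : ℕ} {W : Finset V} (h : BicliqueFree G s t W) :
    BicliqueFree G t s W :=
  fun S T hS hT hSs hTt hST => h T S hT hS hTt hSs fun x hx y hy => (hST y hy x hx).symm

/-- If `X` is joined to `Y`, then adding `X` to the second side of a biclique in `Y` shows that
`Y` contains no biclique `K_{s,t-|X|}`. -/
theorem BicliqueFree.of_join [DecidableEq V] {s t : ℕ} {X Y : Finset V} (h : BicliqueFree G s t (X ∪ Y))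
    (hd : Disjoint X Y) (hXY : ∀ x ∈ X, ∀ y ∈ Y, G.Adj x y) (hX : X.card ≤ t) :
    BicliqueFree G s (t - X.card) Y := by
  intro S T hS hT hSs hTt hST
  refine h S (X ∪ T) (hS.trans Finset.subset_union_right)
    (Finset.union_subset_union_right hT) hSs ?_ ?_
  · rw [Finset.card_union_of_disjoint (hd.mono_right hT), hTt]; omega
  · intro x hx y hy
    rcases Finset.mem_union.1 hy with hy | hy
    · exact (hXY y hy x (hS hx)).symm
    · exact hST x hx y hy

theorem adjCount_self_le (G : SimpleGraph V) (X : Finset V) :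
    adjCount G X X + X.card ≤ X.card * X.card := by
  classical
  have : ∀ x ∈ X, (∑ y ∈ X, if G.Adj x y then 1 else 0) + 1 ≤ X.card := by
    intro x hx
    rw [← Finset.card_filter, ← Finset.card_erase_add_one hx]
    refine Nat.add_le_add_right (Finset.card_le_card fun y hy => ?_) 1
    rw [Finset.mem_filter] at hy
    exact Finset.mem_erase.2 ⟨hy.2.ne', hy.1⟩
  have h := Finset.sum_le_sum this
  rwa [Finset.sum_add_distrib, Finset.sum_const, Finset.sum_const, smul_eq_mul, smul_eq_mul,
    mul_one] at h

/-- Cographs without `K_{s,t}` have at most `(s - 1 + (t - 1) / 2) n` edges. -/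
theorem adjCount_add_le [DecidableEq V] (hG : IsCograph G) (W : Finset V) : ∀ s t : ℕ, 1 ≤ s → 1 ≤ t →
    BicliqueFree G s t W →
    adjCount G W W + (if 2 ≤ s ∧ W.Nonempty then 1 else 0) ≤ (2 * s + t - 3) * W.card := by
  induction W using Finset.strongInduction with
  | H W ih =>
  -- The indicator on the left carries strictness for `2 ≤ s`: it holds for singletons, since then
  -- `2 * s + t - 3` is positive, and survives unions and joins.
  have main : ∀ s t : ℕ, 1 ≤ s → s ≤ t → BicliqueFree G s t W →
      adjCount G W W + (if 2 ≤ s ∧ W.Nonempty then 1 else 0) ≤ (2 * s + t - 3) * W.card := by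
    intro s t hs hst hfree
    rcases Nat.lt_or_ge W.card 2 with hW | hW
    · rcases Nat.eq_zero_or_pos W.card with h0 | h0
      · rw [Finset.card_eq_zero] at h0
        subst h0
        simp [adjCount]
      · obtain ⟨w, rfl⟩ := Finset.card_eq_one.1 (by omega : W.card = 1)
        have : adjCount G {w} {w} = 0 := by simp [adjCount]
        rw [this]
        split_ifs <;> simp
        omega
    have hne : W.Nonempty := Finset.card_pos.1 (by omega)
    obtain ⟨X, Y, hX, hY, hd, rfl, h | h⟩ := isSplit_of_two_le hG W hW
    · wlog hle : X.card ≤ Y.card generalizing X Y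
      · rw [Finset.union_comm]
        rw [Finset.union_comm] at ih hfree hne hW
        exact this Y X hY hX hd.symm ih hfree hW hne (fun x hx y hy => (h y hy x hx).symm)
          (by omega)
      have hXs : X ⊂ X ∪ Y := Finset.ssubset_iff_subset_ne.2 ⟨Finset.subset_union_left, by
        intro he
        obtain ⟨y, hy⟩ := hY
        exact Finset.disjoint_right.1 hd hy (he ▸ Finset.mem_union_right _ hy)⟩
      have hYs : Y ⊂ X ∪ Y := Finset.ssubset_iff_subset_ne.2 ⟨Finset.subset_union_right, by
        intro he
        obtain ⟨y, hy⟩ := hX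
        exact Finset.disjoint_left.1 hd hy (he ▸ Finset.mem_union_left _ hy)⟩
      rw [adjCount_union_self G hd, adjCount_eq_mul G h, Finset.card_union_of_disjoint hd]
      have hXpos := hX.card_pos
      have hYpos := hY.card_pos
      -- If both parts are smaller than `t`, each lowers the second parameter for the other. The
      -- coefficients drop by `X.card` on `Y` and by `Y.card` on `X`, which pays exactly for the `2
      -- * (X.card * Y.card)` cross pairs.
      rcases Nat.lt_or_ge Y.card t with hYt | hYt
      · have h1 := ih Y hYs s (t - X.card) hs (by omega)
          (hfree.of_join hd h (by omega))
        have h2 := ih X hXs s (t - Y.card) hs (by omega)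
          (BicliqueFree.of_join (by rwa [Finset.union_comm]) hd.symm
            (fun x hx y hy => (h y hy x hx).symm) hYt.le)
        have e1 : 2 * s + t - 3 = (2 * s + (t - X.card) - 3) + X.card := by omega
        have e2 : 2 * s + t - 3 = (2 * s + (t - Y.card) - 3) + Y.card := by omega
        have e : (2 * s + t - 3) * (X.card + Y.card) = (2 * s + (t - Y.card) - 3) * X.card +
            (2 * s + (t - X.card) - 3) * Y.card + 2 * (X.card * Y.card) := by
          rw [mul_add]
          nth_rewrite 1 [e2]
          rw [e1]
          ring
        rw [e]
        simp only [hX, hY, hne, and_true] at h1 h2 ⊢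
        split_ifs at h1 h2 ⊢ <;> omega
      -- Now the first parameter drops on `Y`, lowering its coefficient by `2 * X.card`; this alone
      -- pays for the cross pairs, and the trivial bound suffices on `X`.
      · have hXs' : X.card < s := by
          by_contra hcon
          obtain ⟨S, hS, hSs⟩ := Finset.exists_subset_card_eq (not_lt.1 hcon)
          obtain ⟨T, hT, hTt⟩ := Finset.exists_subset_card_eq hYt
          exact hfree S T (hS.trans Finset.subset_union_left) (hT.trans Finset.subset_union_right)
            hSs hTt fun x hx y hy => h x (hS hx) y (hT hy)
        have h1 := ih Y hYs (s - X.card) t (by omega) (by omega)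
          (BicliqueFree.of_join hfree.symm hd h (by omega)).symm
        have h2 := adjCount_self_le G X
        have e1 : 2 * s + t - 3 = (2 * (s - X.card) + t - 3) + 2 * X.card := by omega
        have e : (2 * s + t - 3) * (X.card + Y.card) = (2 * s + t - 3) * X.card +
            (2 * (s - X.card) + t - 3) * Y.card + 2 * (X.card * Y.card) := by
          rw [mul_add]
          nth_rewrite 2 [e1]
          ring
        have h3 : X.card * X.card ≤ (2 * s + t - 3) * X.card :=
          Nat.mul_le_mul_right _ (by omega)
        rw [e]
        split_ifs at h1 ⊢ <;> omega
    · have hXs : X ⊂ X ∪ Y := Finset.ssubset_iff_subset_ne.2 ⟨Finset.subset_union_left, by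
        intro he
        obtain ⟨y, hy⟩ := hY
        exact Finset.disjoint_right.1 hd hy (he ▸ Finset.mem_union_right _ hy)⟩
      have hYs : Y ⊂ X ∪ Y := Finset.ssubset_iff_subset_ne.2 ⟨Finset.subset_union_right, by
        intro he
        obtain ⟨y, hy⟩ := hX
        exact Finset.disjoint_left.1 hd hy (he ▸ Finset.mem_union_left _ hy)⟩
      rw [adjCount_union_self G hd, adjCount_eq_zero G h, Finset.card_union_of_disjoint hd]
      have h1 := ih X hXs s t hs (by omega) (hfree.mono hXs.1)
      have h2 := ih Y hYs s t hs (by omega) (hfree.mono hYs.1)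
      simp only [hX, hY, hne, and_true] at h1 h2 ⊢
      rw [mul_add]
      split_ifs at h1 h2 ⊢ <;> omega
  intro s t hs ht hfree
  rcases Nat.le_total s t with hst | hst
  · exact main s t hs hst hfree
  · rcases Nat.eq_or_lt_of_le hst with rfl | hlt
    · exact main _ _ hs le_rfl hfree
    have h1 := main t s ht hst hfree.symm
    -- For `t < s` the bound with exchanged parameters is smaller by at least one per vertex, which
    -- also covers the indicator.
    have h2 : (2 * t + s - 3) * W.card + W.card ≤ (2 * s + t - 3) * W.card := by
      rw [← Nat.succ_mul]
      exact Nat.mul_le_mul_right _ (by omega)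
    by_cases hW : W.Nonempty
    · have := hW.card_pos
      split_ifs at h1 ⊢ <;> omega
    · simp only [hW, and_false, if_false] at h1 ⊢
      omega

end Density

/-! ### Decomposition into connected components -/

section Components

variable {V : Type*} [DecidableEq V]

/-- Every vertex set decomposes into connected pieces with no edges between them. -/
theorem exists_components (G : SimpleGraph V) (W : Finset V) :
    ∃ 𝒞 : Finset (Finset V), (𝒞 : Set (Finset V)).PairwiseDisjoint id ∧ 𝒞.biUnion id = W ∧
      ∀ C ∈ 𝒞, (G.induce (C : Set V)).Connected ∧ ∀ x ∈ C, ∀ y ∈ W, G.Adj x y → y ∈ C := by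
  classical
  let F : (G.induce (W : Set V)).ConnectedComponent → Finset V := fun c =>
    c.supp.toFinset.map (Function.Embedding.subtype _)
  have hF : ∀ c (x : V), x ∈ F c ↔ ∃ h : x ∈ (W : Set V), (⟨x, h⟩ : (W : Set V)) ∈ c.supp := by
    intro c x
    simp [F]
  refine ⟨Finset.univ.image F, ?_, ?_, ?_⟩
  · intro C hC D hD hCD
    obtain ⟨c, -, rfl⟩ := Finset.mem_image.1 (Finset.mem_coe.1 hC)
    obtain ⟨d, -, rfl⟩ := Finset.mem_image.1 (Finset.mem_coe.1 hD)
    refine Finset.disjoint_left.2 fun x hx hx' => hCD ?_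
    obtain ⟨h, hx⟩ := (hF _ _).1 hx
    obtain ⟨h', hx'⟩ := (hF _ _).1 hx'
    rw [SimpleGraph.ConnectedComponent.eq_of_common_vertex hx hx']
  · ext x
    simp only [Finset.mem_biUnion, Finset.mem_image, Finset.mem_univ, true_and, id]
    constructor
    · rintro ⟨_, ⟨c, rfl⟩, hx⟩
      exact ((hF _ _).1 hx).1
    · intro hx
      exact ⟨_, ⟨(G.induce (W : Set V)).connectedComponentMk ⟨x, hx⟩, rfl⟩,
        (hF _ _).2 ⟨hx, SimpleGraph.ConnectedComponent.connectedComponentMk_mem⟩⟩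
  · intro C hC
    obtain ⟨c, -, rfl⟩ := Finset.mem_image.1 hC
    constructor
    · let f : c.toSimpleGraph →g G.induce (F c : Set V) :=
        ⟨fun x => ⟨x.1.1, (hF _ _).2 ⟨x.1.2, x.2⟩⟩, fun h => h⟩
      refine c.connected_toSimpleGraph.map f ?_
      rintro ⟨x, hx⟩
      obtain ⟨h, hx'⟩ := (hF _ _).1 hx
      exact ⟨⟨⟨x, h⟩, hx'⟩, rfl⟩
    · intro x hx y hy hxy
      obtain ⟨h, hx'⟩ := (hF _ _).1 hx
      refine (hF _ _).2 ⟨hy, c.mem_supp_of_adj_mem_supp hx' ?_⟩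
      exact hxy

theorem exists_adj_of_connected {G : SimpleGraph V} {X Y : Finset V} (hX : X.Nonempty)
    (hY : Y.Nonempty) (hd : Disjoint X Y) (hc : (G.induce ((X ∪ Y : Finset V) : Set V)).Connected) :
    ∃ x ∈ X, ∃ y ∈ Y, G.Adj x y := by
  obtain ⟨x, hx⟩ := hX
  obtain ⟨y, hy⟩ := hY
  obtain ⟨p⟩ := hc.preconnected ⟨x, by simp [hx]⟩ ⟨y, by simp [hy]⟩
  obtain ⟨d, -, h1, h2⟩ := p.exists_boundary_dart {z | z.1 ∈ X} hx
    (fun h => Finset.disjoint_left.1 hd h hy)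
  have h3 := d.snd.2
  rw [Finset.mem_coe, Finset.mem_union] at h3
  exact ⟨_, h1, _, h3.resolve_left h2, d.adj⟩

end Components

/-! ### Large admissible graphs contain many bounded pumps -/

section Pumps

variable {V : Type*}

/-- All vertices of `W` have the same neighbourhood `A` outside of `W`. -/
structure IsModule (G : SimpleGraph V) (A W : Finset V) : Prop where
  disjoint : Disjoint A W
  adj_iff : ∀ v ∈ W, ∀ u ∉ W, (G.Adj v u ↔ u ∈ A)

/-- `H` is a connected module with fewer than `s` neighbours. -/
structure IsPump (G : SimpleGraph V) (s : ℕ) (A H : Finset V) : Prop extends IsModule G A H where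
  card_lt : A.card < s
  connected : (G.induce (H : Set V)).Connected

/-- There are `M` pairwise disjoint pumps in `G` with at most `L` vertices each and with a common
neighbourhood. -/
def HasPumps (G : SimpleGraph V) (s M L : ℕ) : Prop :=
  ∃ (A : Finset V) (ℋ : Finset (Finset V)), ℋ.card = M ∧
    (ℋ : Set (Finset V)).PairwiseDisjoint id ∧ ∀ H ∈ ℋ, IsPump G s A H ∧ H.card ≤ L

theorem HasPumps.mono {G : SimpleGraph V} {s M L L' : ℕ} (h : HasPumps G s M L) (hL : L ≤ L') :
    HasPumps G s M L' := by
  obtain ⟨A, ℋ, h1, h2, h3⟩ := h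
  exact ⟨A, ℋ, h1, h2, fun H hH => ⟨(h3 H hH).1, (h3 H hH).2.trans hL⟩⟩

theorem IsPump.nonempty {G : SimpleGraph V} {s : ℕ} {A H : Finset V} (h : IsPump G s A H) :
    H.Nonempty := by
  obtain ⟨x⟩ := h.connected.nonempty
  exact ⟨x.1, x.2⟩

/-- Here `r` bounds how far `A` is from having `s` vertices. Either all components of `W` are small,
and then many of them serve as pumps over `A`; or a large one is a join, and its larger part is a
module whose neighbourhood has grown. The growth stops because `s` common neighbours of `t` vertices
form a forbidden biclique. -/
theorem exists_pumps_of_isModule (s t M r : ℕ) : ∃ L N : ℕ, ∀ (V : Type) [DecidableEq V]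
    (G : SimpleGraph V) (A W : Finset V), IsCograph G →
    (∀ S T : Finset V, s ≤ S.card → t ≤ T.card → ¬ ∀ x ∈ S, ∀ y ∈ T, G.Adj x y) →
    IsModule G A W → s ≤ A.card + r → N ≤ W.card → HasPumps G s M L := by
  have contra : ∀ (V : Type) (G : SimpleGraph V) (A W : Finset V),
      (∀ S T : Finset V, s ≤ S.card → t ≤ T.card → ¬ ∀ x ∈ S, ∀ y ∈ T, G.Adj x y) →
      IsModule G A W → t ≤ W.card → A.card < s := by
    intro V G A W hfree hmod ht
    by_contra hA
    refine hfree A W (not_lt.1 hA) ht fun x hx y hy => ?_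
    exact ((hmod.adj_iff y hy x (Finset.disjoint_left.1 hmod.disjoint hx)).2 hx).symm
  induction r with
  | zero =>
    refine ⟨0, t, fun V _ G A W hG hfree hmod hs hW => ?_⟩
    exact absurd (contra V G A W hfree hmod hW) (by omega)
  | succ r ih =>
    obtain ⟨L, N, ih⟩ := ih
    refine ⟨max L (2 * N + 1), max t (M * (2 * N + 1)), fun V _ G A W hG hfree hmod hs hW => ?_⟩
    obtain ⟨𝒞, hdisj, hunion, hC⟩ := exists_components G W
    have hsub : ∀ C ∈ 𝒞, C ⊆ W := fun C hC => hunion ▸ Finset.subset_biUnion_of_mem id hC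
    have hmodC : ∀ C ∈ 𝒞, IsModule G A C := by
      intro C hCm
      refine ⟨hmod.disjoint.mono_right (hsub C hCm), fun v hv u hu => ?_⟩
      by_cases huW : u ∈ W
      · refine ⟨fun h => absurd ((hC C hCm).2 v hv u huW h) hu, fun h => ?_⟩
        exact absurd huW (Finset.disjoint_left.1 hmod.disjoint h)
      · exact hmod.adj_iff v (hsub C hCm hv) u huW
    -- The threshold guarantees that the larger part of the join has at least `N` vertices.
    by_cases hbig : ∃ C ∈ 𝒞, 2 * N + 2 ≤ C.card
    · obtain ⟨C, hCm, hcard⟩ := hbig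
      obtain ⟨X, Y, hX, hY, hd, rfl, h | h⟩ := isSplit_of_two_le hG C (by omega)
      · have key : ∀ X Y : Finset V, X.Nonempty → Disjoint X Y → IsModule G A (X ∪ Y) →
            (∀ x ∈ X, ∀ y ∈ Y, G.Adj x y) → N ≤ Y.card → HasPumps G s M L := by
          intro X Y hX hd hmodXY h hN
          have hAX := hmodXY.disjoint.mono_right Finset.subset_union_left
          refine ih V G (A ∪ X) Y hG hfree ⟨?_, fun v hv u hu => ?_⟩ ?_ hN
          · exact Finset.disjoint_union_left.2
              ⟨hmodXY.disjoint.mono_right Finset.subset_union_right, hd⟩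
          · by_cases huX : u ∈ X
            · simp [huX, (h u huX v hv).symm]
            · simp only [Finset.mem_union, huX, or_false]
              exact hmodXY.adj_iff v (Finset.mem_union_right _ hv) u (by simp [hu, huX])
          · rw [Finset.card_union_of_disjoint hAX]
            have := hX.card_pos
            omega
        rw [Finset.card_union_of_disjoint hd] at hcard
        refine HasPumps.mono ?_ (le_max_left _ _)
        rcases Nat.le_total X.card Y.card with hle | hle
        · exact key X Y hX hd (hmodC _ hCm) h (by omega)
        · exact key Y X hY hd.symm (by rw [Finset.union_comm]; exact hmodC _ hCm)
            (fun x hx y hy => (h y hy x hx).symm) (by omega)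
      · obtain ⟨x, hx, y, hy, hxy⟩ := exists_adj_of_connected hX hY hd (hC _ hCm).1
        exact absurd hxy (h x hx y hy)
    · push Not at hbig
      have hcard : W.card ≤ 𝒞.card * (2 * N + 1) := by
        rw [← hunion]
        exact Finset.card_biUnion_le_card_mul _ _ _ fun C hC => by
          have := hbig C hC
          simp only [id]
          omega
      have hM : M ≤ 𝒞.card := by
        have : M * (2 * N + 1) ≤ 𝒞.card * (2 * N + 1) :=
          ((le_max_right _ _).trans hW).trans hcard
        exact Nat.le_of_mul_le_mul_right this (by omega)
      obtain ⟨ℋ, hℋ, hℋM⟩ := Finset.exists_subset_card_eq hM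
      refine ⟨A, ℋ, hℋM, hdisj.subset (by exact_mod_cast hℋ), fun H hH => ?_⟩
      have hHC := hℋ hH
      refine ⟨⟨hmodC H hHC, contra V G A W hfree hmod ((le_max_left _ _).trans hW),
        (hC H hHC).1⟩, ?_⟩
      have := hbig H hHC
      exact le_max_of_le_right (by omega)

theorem exists_pumps {P : BicliqueProfile} {s t : ℕ} (hP : Admissible P s t) (M : ℕ) :
    ∃ L N : ℕ, ∀ n (G : SimpleGraph (Fin n)), N ≤ n → Good P G → HasPumps G s M L := by
  obtain ⟨L, N, h⟩ := exists_pumps_of_isModule s t M s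
  refine ⟨L, N, fun n G hn hG => ?_⟩
  exact h (Fin n) G ∅ Finset.univ hG.1 (hG.not_biclique hP) ⟨by simp, by simp⟩ (by simp)
    (by simpa using hn)

/-- A pump as a designated component of a core graph. -/
noncomputable def IsPump.core {n s : ℕ} {G : SimpleGraph (Fin n)} {A H : Finset (Fin n)}
    (h : IsPump G s A H) : PumpingCore where
  size := n
  graph := G
  comp := (⊤ : G.Subgraph).induce H
  induced := (SimpleGraph.Subgraph.isInduced_iff_exists_eq_induce_top _).2 ⟨_, rfl⟩
  connected := SimpleGraph.connected_induce_iff.1 h.connected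
  same_neighbours := fun v hv w hw u hu =>
    (h.adj_iff v (by simpa using hv) u (by simpa using hu)).trans
      (h.adj_iff w (by simpa using hw) u (by simpa using hu)).symm

variable {P : BicliqueProfile} {s t : ℕ}

theorem IsPump.good_pump (hP : Admissible P s t) {n : ℕ} {G : SimpleGraph (Fin n)}
    {A H : Finset (Fin n)} (h : IsPump G s A H) (hG : Good P G) (k : ℕ) :
    Good P (pump h.core.comp k) :=
  ⟨isCograph_pump h.core.induced h.core.same_neighbours hG.1 k,
    fulfills_pump hP h.card_lt
      (fun v hv u hu hvu => (h.adj_iff v (by simpa [core] using hv) u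
        (by simpa [core] using hu)).1 hvu) hG.2 k⟩

theorem IsPump.mem_core {n : ℕ} {G : SimpleGraph (Fin n)} {A H : Finset (Fin n)}
    (h : IsPump G s A H) (v : Fin n) : v ∈ H ↔ v ∈ h.core.comp.verts :=
  Iff.rfl

theorem IsPump.card_pump {n : ℕ} {G : SimpleGraph (Fin n)} {A H : Finset (Fin n)}
    (h : IsPump G s A H) (k : ℕ) :
    Nat.card (PumpVertex h.core.comp k) = n + k * H.card := by
  have h1 : H.card ≤ n := by simpa using H.card_le_univ
  have h2 : Hᶜ.card = n - H.card := by simp [Finset.card_compl]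
  refine (card_pumpVertex h.core.comp h.mem_core k).trans ?_
  change Hᶜ.card + (k + 1) * H.card = n + k * H.card
  rw [h2, add_mul]
  omega

theorem IsPump.two_mul_edgeCount {n : ℕ} {G : SimpleGraph (Fin n)} {A H : Finset (Fin n)}
    (h : IsPump G s A H) (k : ℕ) :
    2 * edgeCount (pump h.core.comp k) = 2 * edgeCount G + k * weight G H := by
  refine (two_mul_edgeCount_pump h.core.induced h.mem_core k).trans ?_
  change adjCount G Hᶜ Hᶜ + (k + 1) * weight G H = _
  rw [adjCount_split G H, weight]
  ring

end Pumps

/-! ### Subadditivity and boundedness of the weight -/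

section Weight

variable {V : Type*} [Fintype V] [DecidableEq V] (G : SimpleGraph V)

/-- Edges between `X` and `Y` are counted in both terms on the right but only once on the left. -/
theorem weight_union_le {X Y : Finset V} (h : Disjoint X Y) :
    weight G (X ∪ Y) ≤ weight G X + weight G Y := by
  have hX : Xᶜ = (X ∪ Y)ᶜ ∪ Y := by
    ext v
    have : v ∈ Y → v ∉ X := fun hv hv' => Finset.disjoint_left.1 h hv' hv
    simp only [Finset.mem_compl, Finset.mem_union]
    tauto
  have hY : Yᶜ = (X ∪ Y)ᶜ ∪ X := by
    ext v
    have : v ∈ Y → v ∉ X := fun hv hv' => Finset.disjoint_left.1 h hv' hv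
    simp only [Finset.mem_compl, Finset.mem_union]
    tauto
  have dX : Disjoint (X ∪ Y)ᶜ Y := disjoint_compl_left.mono_right Finset.subset_union_right
  have dY : Disjoint (X ∪ Y)ᶜ X := disjoint_compl_left.mono_right Finset.subset_union_left
  have eX : adjCount G X Xᶜ = adjCount G X (X ∪ Y)ᶜ + adjCount G X Y := by
    rw [hX, adjCount_comm, adjCount_union_left G dX, adjCount_comm, adjCount_comm G Y]
  have eY : adjCount G Y Yᶜ = adjCount G Y (X ∪ Y)ᶜ + adjCount G X Y := by
    rw [hY, adjCount_comm, adjCount_union_left G dY, adjCount_comm]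
  rw [weight, weight, weight, eX, eY, adjCount_union_self G h, adjCount_union_left G h]
  omega

theorem weight_biUnion_le (ℋ : Finset (Finset V))
    (h : (ℋ : Set (Finset V)).PairwiseDisjoint id) :
    weight G (ℋ.biUnion id) ≤ ∑ H ∈ ℋ, weight G H := by
  induction ℋ using Finset.induction_on with
  | empty => simp [weight, adjCount]
  | insert H ℋ hH ih =>
    rw [Finset.biUnion_insert, Finset.sum_insert hH]
    rw [Finset.coe_insert, Set.pairwiseDisjoint_insert] at h
    refine (weight_union_le G ?_).trans (Nat.add_le_add_left (ih h.1) _)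
    rw [Finset.disjoint_biUnion_right]
    intro H' hH'
    exact h.2 H' hH' (by rintro rfl; exact hH hH')

theorem IsPump.weight_le {G : SimpleGraph V} {s : ℕ} {A H : Finset V} (h : IsPump G s A H) :
    weight G H ≤ H.card * H.card + 2 * (H.card * s) := by
  classical
  refine Nat.add_le_add (adjCount_le G H H) (Nat.mul_le_mul_left 2 ?_)
  rw [adjCount, ← smul_eq_mul, ← Finset.sum_const]
  refine Finset.sum_le_sum fun x hx => ?_
  rw [← Finset.card_filter]
  refine le_trans (Finset.card_le_card (t := A) fun y hy => ?_) h.card_lt.le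
  simp only [Finset.mem_filter, Finset.mem_compl] at hy
  exact (h.adj_iff x hx y hy.1).1 hy.2

end Weight

/-- Removes a bounded error by letting the multiplier grow. -/
theorem le_of_forall_exists_mul_le {a b C : ℕ} (h : ∀ K : ℕ, ∃ k, K ≤ k ∧ k * a ≤ k * b + C) :
    a ≤ b := by
  by_contra hlt
  obtain ⟨k, hk, hle⟩ := h (C + 1)
  have : k * (b + 1) ≤ k * a := Nat.mul_le_mul_left _ (by omega)
  rw [mul_add] at this
  omega

/-! ### The slope of the extremal function and the pumping family -/

section Asymptotics

variable {P : BicliqueProfile} {s t : ℕ}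

theorem IsPump.le_ex (hP : Admissible P s t) {n : ℕ} {G : SimpleGraph (Fin n)}
    {A H : Finset (Fin n)} (h : IsPump G s A H) (hG : Good P G) (k : ℕ) :
    2 * edgeCount G + k * weight G H ≤ 2 * P.ex (n + k * H.card) := by
  classical
  have : Fintype (PumpVertex h.core.comp k) := Fintype.ofFinite _
  have h1 := (h.good_pump hP hG k).edgeCount_le_ex
  rw [← Nat.card_eq_fintype_card, h.card_pump] at h1
  have h2 := h.two_mul_edgeCount k
  omega

theorem two_mul_ex_le_sq (hP : Admissible P s t) (n : ℕ) : 2 * P.ex n ≤ n * n := by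
  obtain ⟨G, hG, he⟩ := exists_good_edgeCount_eq_ex hP n
  rw [← he]
  simpa using two_mul_edgeCount_le G

/-- `p / h` is the slope of `2 * ex`, and `D` bounds the deviation. -/
structure HasSlope (P : BicliqueProfile) (p h D : ℕ) : Prop where
  pos : 0 < h
  upper : ∀ n, h * (2 * P.ex n) ≤ p * n
  lower : ∀ n, p * n ≤ h * (2 * P.ex n) + D

/-- The maximum of weight over size exists because both are bounded: the pump has at most `L`
vertices and fewer than `s` outside neighbours. -/
theorem exists_max_pump (hP : Admissible P s t) (L N : ℕ)
    (hL : ∀ n (G : SimpleGraph (Fin n)), N ≤ n → Good P G → HasPumps G s 1 L) :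
    ∃ (n : ℕ) (G : SimpleGraph (Fin n)) (A H : Finset (Fin n)), Good P G ∧ IsPump G s A H ∧
      ∀ (n' : ℕ) (G' : SimpleGraph (Fin n')) (A' H' : Finset (Fin n')), Good P G' →
        IsPump G' s A' H' → H'.card ≤ L → H.card * weight G' H' ≤ weight G H * H'.card := by
  let T : Set (ℕ × ℕ) := {x | ∃ (n : ℕ) (G : SimpleGraph (Fin n)) (A H : Finset (Fin n)),
    Good P G ∧ IsPump G s A H ∧ H.card ≤ L ∧ x = (weight G H, H.card)}
  have hfin : T.Finite := by
    refine (Set.finite_Iic (L * L + 2 * (L * s), L)).subset ?_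
    rintro _ ⟨n, G, A, H, hG, hH, hle, rfl⟩
    refine ⟨hH.weight_le.trans ?_, hle⟩
    exact Nat.add_le_add (Nat.mul_le_mul hle hle)
      (Nat.mul_le_mul_left 2 (Nat.mul_le_mul_right s hle))
  have hne : T.Nonempty := by
    obtain ⟨A, ℋ, hM, -, hℋ⟩ := hL N ⊥ le_rfl (good_bot hP _)
    obtain ⟨H, rfl⟩ := Finset.card_eq_one.1 hM
    obtain ⟨h1, h2⟩ := hℋ H (by simp)
    exact ⟨_, N, ⊥, A, H, good_bot hP _, h1, h2, rfl⟩
  obtain ⟨_, ⟨n, G, A, H, hG, hH, hle, rfl⟩, hmax⟩ :=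
    Set.exists_max_image T (fun x => (x.1 : ℚ) / x.2) hfin hne
  refine ⟨n, G, A, H, hG, hH, fun n' G' A' H' hG' hH' hle' => ?_⟩
  have := hmax _ ⟨n', G', A', H', hG', hH', hle', rfl⟩
  have p1 : (0 : ℚ) < H.card := by exact_mod_cast hH.nonempty.card_pos
  have p2 : (0 : ℚ) < H'.card := by exact_mod_cast hH'.nonempty.card_pos
  rw [div_le_div_iff₀ p2 p1] at this
  rw [mul_comm]
  exact_mod_cast this

theorem exists_hasSlope (hP : Admissible P s t) : ∃ p h D, HasSlope P p h D := by
  obtain ⟨L, N, hL⟩ := exists_pumps hP 1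
  obtain ⟨n0, G0, A0, H0, hG0, hH0, hmax⟩ := exists_max_pump hP L N hL
  set p := weight G0 H0
  set h := H0.card
  have hpos : 0 < h := hH0.nonempty.card_pos
  -- The deviation allows for the `n0` vertices of the initial graph and for the remainder modulo
  -- `h`.
  refine ⟨p, h, p * (n0 + h), hpos, fun n => ?_, fun n => ?_⟩
  -- Deleting one pump at a time costs at most slope `p / h`, up to an error from orders below `N`.
  · have upper : ∀ n, h * (2 * P.ex n) ≤ p * n + h * (N * N) := by
      intro n
      induction n using Nat.strong_induction_on with
      | _ n ih =>
      rcases Nat.lt_or_ge n N with hn | hn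
      · have := two_mul_ex_le_sq hP n
        have h2 : n * n ≤ N * N := Nat.mul_le_mul hn.le hn.le
        exact (Nat.mul_le_mul_left h (this.trans h2)).trans (Nat.le_add_left _ _)
      · obtain ⟨G, hG, he⟩ := exists_good_edgeCount_eq_ex hP n
        obtain ⟨A, ℋ, hM, -, hℋ⟩ := hL n G hn hG
        obtain ⟨H, rfl⟩ := Finset.card_eq_one.1 hM
        obtain ⟨hH, hle⟩ := hℋ H (by simp)
        have h1 := hG.two_mul_edgeCount_le_removal H
        rw [he, Fintype.card_fin] at h1
        have hpos := hH.nonempty.card_pos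
        have hHn : H.card ≤ n := by simpa using H.card_le_univ
        have h2 := ih (n - H.card) (by omega)
        have h3 := hmax n G A H hG hH hle
        have h4 := Nat.mul_le_mul_left h h1
        rw [mul_add] at h4
        have h5 : p * n = p * (n - H.card) + p * H.card := by rw [← mul_add]; congr 1; omega
        omega
    -- Superadditivity, applied to `K` copies, eliminates this error.
    refine le_of_forall_exists_mul_le (C := h * (N * N)) fun K => ⟨K, le_rfl, ?_⟩
    calc K * (h * (2 * P.ex n)) = h * (2 * (K * P.ex n)) := by ring
      _ ≤ h * (2 * P.ex (K * n)) := by gcongr; exact mul_ex_le hP K n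
      _ ≤ p * (K * n) + h * (N * N) := upper _
      _ = _ := by ring
  · rcases Nat.lt_or_ge n n0 with hn | hn
    · have : p * n ≤ p * (n0 + h) := Nat.mul_le_mul_left _ (by omega)
      omega
    · have h1 := hH0.le_ex hP hG0 ((n - n0) / h)
      have h2 := Nat.div_add_mod (n - n0) h
      have h3 := Nat.mod_lt (n - n0) hpos
      have h4 : P.ex (n0 + (n - n0) / h * h) ≤ P.ex n := by
        refine ex_mono hP ?_
        rw [mul_comm]
        omega
      have h5 : (n - n0) / h * p ≤ 2 * P.ex n := by
        change _ + _ * p ≤ 2 * P.ex (n0 + _ * h) at h1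
        omega
      have h6 := Nat.mul_le_mul_left h h5
      have h7 : n ≤ h * ((n - n0) / h) + (n0 + h) := by omega
      calc p * n ≤ p * (h * ((n - n0) / h) + (n0 + h)) := Nat.mul_le_mul_left _ h7
        _ = h * ((n - n0) / h * p) + p * (n0 + h) := by ring
        _ ≤ _ := by omega

variable {p h D : ℕ}

theorem HasSlope.weight_le (hS : HasSlope P p h D) (hP : Admissible P s t) {n : ℕ}
    {G : SimpleGraph (Fin n)} {A H : Finset (Fin n)} (hH : IsPump G s A H) (hG : Good P G) :
    h * weight G H ≤ p * H.card := by
  refine le_of_forall_exists_mul_le (C := p * n) fun k => ⟨k, le_rfl, ?_⟩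
  have h1 := hH.le_ex hP hG k
  calc k * (h * weight G H) = h * (k * weight G H) := by ring
    _ ≤ h * (2 * P.ex (n + k * H.card)) := Nat.mul_le_mul_left _ (by omega)
    _ ≤ p * (n + k * H.card) := hS.upper _
    _ = _ := by ring

/-- Large extremal cographs contain a bounded pump of maximal slope. -/
theorem HasSlope.exists_tight_pump (hS : HasSlope P p h D) (hP : Admissible P s t) :
    ∃ L N : ℕ, ∀ n (G : SimpleGraph (Fin n)), N ≤ n → Good P G → edgeCount G = P.ex n →
      ∃ A H, IsPump G s A H ∧ H.card ≤ L ∧ h * weight G H = p * H.card := by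
  -- Each non-tight pump loses at least one unit by integrality. With `D + 1` of them, their union
  -- would have too little weight compared with the lower bound for `ex` on as many vertices.
  obtain ⟨L, N, hL⟩ := exists_pumps hP (D + 1)
  refine ⟨L, N, fun n G hn hG he => ?_⟩
  obtain ⟨A, ℋ, hM, hdisj, hℋ⟩ := hL n G hn hG
  by_contra! hcon
  have hlt : ∀ H ∈ ℋ, h * weight G H + 1 ≤ p * H.card := fun H hH =>
    lt_of_le_of_ne (hS.weight_le hP (hℋ H hH).1 hG) (hcon A H (hℋ H hH).1 (hℋ H hH).2)
  have hsum := Finset.sum_le_sum hlt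
  rw [Finset.sum_add_distrib, ← Finset.mul_sum, ← Finset.mul_sum, Finset.sum_const, smul_eq_mul,
    mul_one, hM] at hsum
  have hcard : (ℋ.biUnion id).card = ∑ H ∈ ℋ, H.card := Finset.card_biUnion hdisj
  rw [← hcard] at hsum
  have hle : (ℋ.biUnion id).card ≤ n := by simpa using (ℋ.biUnion id).card_le_univ
  have h1 := hG.two_mul_edgeCount_le_removal (ℋ.biUnion id)
  have h2 := ex_add_le hP (n - (ℋ.biUnion id).card) (ℋ.biUnion id).card
  rw [Nat.sub_add_cancel hle] at h2
  rw [he, Fintype.card_fin] at h1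
  have h3 := weight_biUnion_le G ℋ hdisj
  have h4 := hS.lower (ℋ.biUnion id).card
  have h5 : h * (2 * P.ex (ℋ.biUnion id).card) ≤ h * ∑ H ∈ ℋ, weight G H :=
    Nat.mul_le_mul_left _ (by omega)
  omega

/-- For every residue class there is a core whose pumpings are extremal. -/
theorem HasSlope.exists_core (hS : HasSlope P p h D) (hP : Admissible P s t) {L N R : ℕ}
    (hR : 0 < R) (hLR : ∀ l, 1 ≤ l → l ≤ L → l ∣ R)
    (hL : ∀ n (G : SimpleGraph (Fin n)), N ≤ n → Good P G → edgeCount G = P.ex n →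
      ∃ A H, IsPump G s A H ∧ H.card ≤ L ∧ h * weight G H = p * H.card) (j : ZMod R) :
    ∃ (C : PumpingCore) (δ : ℕ), ∀ n : ℕ, C.size ≤ n → (n : ZMod R) = j →
      h * (2 * P.ex n) + δ = p * n ∧
      ∃ k, Nat.card (PumpVertex C.comp k) = n ∧ P.IsExtremalCograph (pump C.comp k) := by
  have : NeZero R := ⟨hR.ne'⟩
  let S : Set ℕ := {n | N ≤ n ∧ (n : ZMod R) = j}
  have hne : S.Nonempty := by
    refine ⟨j.val + R * N, ?_, by simp⟩
    exact (Nat.le_mul_of_pos_left N hR).trans (Nat.le_add_left _ _)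
  -- The subtraction is not truncated, by `hS.upper`. Tight pumping preserves this deficiency, so
  -- its minimality forces the pumped graphs to be extremal.
  obtain ⟨m, ⟨hmN, hmj⟩, hmin⟩ :=
    (measure fun n => p * n - h * (2 * P.ex n)).wf.has_min S hne
  obtain ⟨G, hG, he⟩ := exists_good_edgeCount_eq_ex hP m
  obtain ⟨A, H, hH, hHL, htight⟩ := hL m G hmN hG he
  refine ⟨hH.core, p * m - h * (2 * P.ex m), fun n hn hnj => ?_⟩
  change m ≤ n at hn
  obtain ⟨i, hi⟩ : R ∣ n - m := by
    rw [← Nat.modEq_iff_dvd' hn, ← ZMod.natCast_eq_natCast_iff, hmj, hnj]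
  -- As the pump size divides `R`, every larger order in the class is reached exactly.
  obtain ⟨l, hl⟩ := hLR H.card hH.nonempty.card_pos hHL
  have hcard : Nat.card (PumpVertex hH.core.comp (l * i)) = n := by
    rw [hH.card_pump]
    have : l * i * H.card = n - m := by rw [hi, hl]; ring
    omega
  have hedge := hH.two_mul_edgeCount (l * i)
  have hgood := hH.good_pump hP hG (l * i)
  have : Fintype (PumpVertex hH.core.comp (l * i)) := Fintype.ofFinite _
  have hle := hgood.edgeCount_le_ex
  rw [← Nat.card_eq_fintype_card, hcard] at hle
  have hnot : ¬ p * n - h * (2 * P.ex n) < p * m - h * (2 * P.ex m) := hmin n ⟨hmN.trans hn, hnj⟩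
  have hun := hS.upper n
  have hum := hS.upper m
  have e1 : h * (2 * edgeCount (pump hH.core.comp (l * i))) =
      h * (2 * P.ex m) + p * (n - m) := by
    rw [hedge, he, mul_add]
    congr 1
    calc h * (l * i * weight G H) = l * i * (h * weight G H) := by ring
      _ = p * (H.card * l * i) := by rw [htight]; ring
      _ = _ := by rw [hi, ← hl]
  have e2 : p * n = p * m + p * (n - m) := by rw [← mul_add]; congr 1; omega
  have hle' : h * (2 * edgeCount (pump hH.core.comp (l * i))) ≤ h * (2 * P.ex n) :=
    Nat.mul_le_mul_left _ (by omega)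
  have heq : h * (2 * edgeCount (pump hH.core.comp (l * i))) = h * (2 * P.ex n) := by omega
  refine ⟨by omega, l * i, hcard, ?_⟩
  rw [isExtremalCograph_iff hP, ← Nat.card_eq_fintype_card, hcard]
  refine ⟨hgood, ?_⟩
  have := Nat.eq_of_mul_eq_mul_left hS.pos heq
  omega

theorem HasSlope.exists_pumpingFamily (hS : HasSlope P p h D) (hP : Admissible P s t) :
    ∃ (N R : ℕ) (C : ZMod R → PumpingCore) (δ : ZMod R → ℕ), 0 < R ∧ (∀ j, (C j).size ≤ N) ∧
      IsPumpingFamily P C ∧ ∀ᶠ n : ℕ in atTop, h * (2 * P.ex n) + δ n = p * n := by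
  obtain ⟨L, N, hL⟩ := hS.exists_tight_pump hP
  have hR : 0 < L.factorial := L.factorial_pos
  have : NeZero L.factorial := ⟨hR.ne'⟩
  choose C δ hC using hS.exists_core hP hR (fun l h1 h2 => Nat.dvd_factorial h1 h2) hL
  have hsize : ∀ j, (C j).size ≤ Finset.univ.sup fun j => (C j).size := fun j =>
    Finset.le_sup (f := fun j => (C j).size) (Finset.mem_univ j)
  refine ⟨Finset.univ.sup fun j => (C j).size, L.factorial, C, δ, hR, hsize, ?_, ?_⟩
  · filter_upwards [eventually_ge_atTop (Finset.univ.sup fun j => (C j).size)] with n hn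
    exact (hC n n ((hsize _).trans hn) rfl).2
  · filter_upwards [eventually_ge_atTop (Finset.univ.sup fun j => (C j).size)] with n hn
    exact (hC n n ((hsize _).trans hn) rfl).1

end Asymptotics

/-! ### Bounds on the slope -/

section DensityBounds

variable {P : BicliqueProfile} {s t : ℕ}

theorem Good.adjCount_le {V : Type*} [DecidableEq V] {G : SimpleGraph V} (hP : Admissible P s t)
    (hG : Good P G) (W : Finset V) :
    adjCount G W W + (if 2 ≤ s ∧ W.Nonempty then 1 else 0) ≤ (2 * s + t - 3) * W.card :=
  adjCount_add_le hG.1 W s t hP.one_le_start hP.one_le_value fun S T _ _ hS hT =>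
    hG.not_biclique hP S T hS.ge hT.ge

theorem two_mul_ex_le (hP : Admissible P s t) (n : ℕ) :
    2 * P.ex n + (if 2 ≤ s ∧ 0 < n then 1 else 0) ≤ (2 * s + t - 3) * n := by
  obtain ⟨G, hG, he⟩ := exists_good_edgeCount_eq_ex hP n
  have := hG.adjCount_le hP Finset.univ
  simpa only [adjCount_univ, he, ← Finset.card_pos, Finset.card_univ, Fintype.card_fin] using this

theorem HasSlope.le {p h D : ℕ} (hS : HasSlope P p h D) (hP : Admissible P s t) :
    p ≤ h * (2 * s + t - 3) := by
  refine le_of_forall_exists_mul_le (C := D) fun n => ⟨n, le_rfl, ?_⟩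
  have h1 := hS.lower n
  have h2 : h * (2 * P.ex n) ≤ h * ((2 * s + t - 3) * n) :=
    Nat.mul_le_mul_left _ (le_of_add_le_left (two_mul_ex_le hP n))
  calc n * p = p * n := mul_comm _ _
    _ ≤ h * ((2 * s + t - 3) * n) + D := by omega
    _ = _ := by ring

/-- The core graph is an induced subgraph of its pumpings. -/
theorem Good.of_pump {V : Type*} {G : SimpleGraph V} {H : G.Subgraph} (hind : H.IsInduced)
    {k : ℕ} (h : Good P (pump H k)) : Good P G := by
  classical
  let f : V → PumpVertex H k := fun v =>
    if hv : v ∈ H.verts then .inr (⟨v, hv⟩, 0) else .inl ⟨v, hv⟩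
  have hf : ∀ v, Sum.elim Subtype.val (fun p => p.1.1) (f v) = v := by
    intro v
    by_cases hv : v ∈ H.verts <;> simp [f, hv]
  refine h.of_embedding ⟨⟨f, fun x y hxy => by rw [← hf x, hxy, hf y]⟩, ?_⟩
  intro x y
  change (pump H k).Adj (f x) (f y) ↔ _
  refine ⟨fun hxy => by simpa only [hf] using pump_adj_proj hxy, fun hxy => ?_⟩
  by_cases hx : x ∈ H.verts <;> by_cases hy : y ∈ H.verts
  · rw [show f x = .inr (⟨x, hx⟩, 0) from dif_pos hx, show f y = .inr (⟨y, hy⟩, 0) from dif_pos hy]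
    exact ⟨rfl, hind hx hy hxy⟩
  · rwa [show f x = .inr (⟨x, hx⟩, 0) from dif_pos hx, show f y = .inl ⟨y, hy⟩ from dif_neg hy]
  · rwa [show f x = .inl ⟨x, hx⟩ from dif_neg hx, show f y = .inr (⟨y, hy⟩, 0) from dif_pos hy]
  · rwa [show f x = .inl ⟨x, hx⟩ from dif_neg hx, show f y = .inl ⟨y, hy⟩ from dif_neg hy]

/-- A component has no outgoing edges, so its weight is only its inner density, which is strictly
below the bound for `2 ≤ s`. Yet unbounded extremal pumping of it must produce the full slope. -/
theorem HasSlope.lt_of_isConnectedComponent {p h D : ℕ} (hS : HasSlope P p h D)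
    (hP : Admissible P s t) (hs : 2 ≤ s) {R : ℕ} {C : ZMod R → PumpingCore} (hR : 0 < R)
    (hC : IsPumpingFamily P C) {q : ZMod R} (hq : (C q).IsConnectedComponent) :
    p < h * (2 * s + t - 3) := by
  classical
  have : NeZero R := ⟨hR.ne'⟩
  obtain ⟨c, hc⟩ := hq
  obtain ⟨n0, hn0⟩ := eventually_atTop.1 hC
  set X := (C q).comp.verts.toFinset with hXdef
  have hX : ∀ v, v ∈ X ↔ v ∈ (C q).comp.verts := by simp [hXdef]
  have hXne : X.Nonempty := by
    obtain ⟨x, hx⟩ := (C q).connected.nonempty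
    exact ⟨x, (hX x).2 hx⟩
  have hpump : ∀ K : ℕ, ∃ k, K ≤ k ∧ Good P (pump (C q).comp k) ∧
      Xᶜ.card + (k + 1) * X.card = Nat.card (PumpVertex (C q).comp k) ∧
      edgeCount (pump (C q).comp k) = P.ex (Nat.card (PumpVertex (C q).comp k)) := by
    intro K
    obtain ⟨n, hn, hnq⟩ : ∃ n : ℕ, n0 + Xᶜ.card + (K + 1) * X.card ≤ n ∧ (n : ZMod R) = q := by
      refine ⟨q.val + R * (n0 + Xᶜ.card + (K + 1) * X.card), ?_, by simp⟩
      exact (Nat.le_mul_of_pos_left _ hR).trans (Nat.le_add_left _ _)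
    have h1 := hn0 n (by omega)
    rw [hnq] at h1
    obtain ⟨k, hcard, hext⟩ := h1
    have : Fintype (PumpVertex (C q).comp k) := Fintype.ofFinite _
    rw [isExtremalCograph_iff hP, ← Nat.card_eq_fintype_card] at hext
    have h2 := card_pumpVertex (C q).comp hX k
    refine ⟨k, ?_, hext.1, h2.symm, hext.2⟩
    have h3 : (K + 1) * X.card ≤ (k + 1) * X.card := by omega
    have := Nat.le_of_mul_le_mul_right h3 hXne.card_pos
    omega
  have hzero : adjCount (C q).graph X Xᶜ = 0 := by
    refine adjCount_eq_zero _ fun x hx y hy hxy => ?_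
    rw [Finset.mem_compl, hX, ← hc] at hy
    rw [hX, ← hc] at hx
    exact hy (c.mem_supp_of_adj_mem_supp hx hxy)
  have hw : weight (C q).graph X = adjCount (C q).graph X X := by rw [weight, hzero]; rfl
  have hle : p * X.card ≤ h * adjCount (C q).graph X X := by
    refine le_of_forall_exists_mul_le
      (C := h * (adjCount (C q).graph Xᶜ Xᶜ + weight (C q).graph X) + D) fun K => ?_
    obtain ⟨k, hk, -, hcard, hedge⟩ := hpump K
    refine ⟨k, hk, ?_⟩
    have h1 := hS.lower (Nat.card (PumpVertex (C q).comp k))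
    rw [← hedge, two_mul_edgeCount_pump (C q).induced hX, ← hcard] at h1
    calc k * (p * X.card) ≤ p * (Xᶜ.card + (k + 1) * X.card) := by
          rw [show k * (p * X.card) = p * (k * X.card) by ring]
          refine Nat.mul_le_mul_left _ ?_
          rw [add_mul]
          omega
      _ ≤ _ := h1
      _ = _ := by rw [hw]; ring
  obtain ⟨k, -, hgood, -⟩ := hpump 0
  have hlt := (hgood.of_pump (C q).induced).adjCount_le hP X
  rw [if_pos ⟨hs, hXne⟩] at hlt
  have h3 : h * (adjCount (C q).graph X X + 1) ≤ h * ((2 * s + t - 3) * X.card) :=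
    Nat.mul_le_mul_left _ hlt
  have h4 := hS.pos
  refine Nat.lt_of_mul_lt_mul_right (a := X.card) ?_
  rw [mul_assoc]
  rw [mul_add] at h3
  omega

end DensityBounds

/-! ### Finiteness of the set of profiles, and the theorem -/

theorem exists_nat_eq_of_le {x : WithBot ℕ∞} {m : ℕ} (h0 : ((0 : ℕ) : ℕ∞) ≤ x)
    (h : x ≤ ((m : ℕ∞) : WithBot ℕ∞)) : ∃ i ≤ m, ((i : ℕ∞) : WithBot ℕ∞) = x := by
  induction x with
  | bot => exact absurd h0 (by simp)
  | coe e =>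
    rw [WithBot.coe_le_coe] at h
    obtain ⟨i, rfl⟩ := ENat.ne_top_iff_exists.1 (ne_top_of_le_ne_top (ENat.natCast_ne_top m) h)
    exact ⟨i, Nat.cast_le.1 h, rfl⟩

/-- There are only finitely many profiles with given start-index and start value. -/
theorem finite_admissible (s t : ℕ) : {P : BicliqueProfile | Admissible P s t}.Finite := by
  let F : BicliqueProfile → Fin (t + 1) → WithBot ℕ∞ := fun P i => P.val i
  refine Set.Finite.of_finite_image (f := F) ?_ ?_
  -- Values are infinite before `s` and lie in `0, ..., t - 1` from `s` on.
  · let B : Finset (WithBot ℕ∞) :=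
      insert ⊤ ((Finset.range t).image fun i : ℕ => ((i : ℕ∞) : WithBot ℕ∞))
    refine (Set.Finite.pi' (t := fun _ : Fin (t + 1) => (B : Set (WithBot ℕ∞)))
      fun _ => B.finite_toSet).subset ?_
    rintro _ ⟨P, hP, rfl⟩ i
    simp only [B, F, Finset.coe_insert, Finset.coe_image, Set.mem_insert_iff, Set.mem_image]
    rcases Nat.lt_or_ge i.1 s with hi | hi
    · exact Or.inl (hP.top_of_lt _ hi)
    · right
      have h1 := P.antitone hi
      rw [hP.val_start] at h1
      have ht := hP.one_le_value
      obtain ⟨k, hk, he⟩ := exists_nat_eq_of_le (hP.le_val 0 hP.one_le_start i) h1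
      exact ⟨k, by rw [Finset.mem_coe, Finset.mem_range]; omega, he⟩
  · intro P hP Q hQ h
    have hval : ∀ i ≤ t, P.val i = Q.val i := fun i hi =>
      congrFun h (⟨i, Nat.lt_succ_of_le hi⟩ : Fin (t + 1))
    -- From index `t` on, `P.val s < i` gives `P.val i < s`, while all values are at least `s - 1`;
    -- so the first `t + 1` values determine the profile.
    have htail : ∀ P : BicliqueProfile, Admissible P s t → ∀ i, t ≤ i →
        P.val i = (((s - 1 : ℕ) : ℕ∞) : WithBot ℕ∞) := by
      intro P hP i hi
      have hs := hP.one_le_start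
      refine le_antisymm ?_ (hP.le_val (s - 1) (by omega) i)
      have h1 := P.subdiagonal s i (by
        rw [hP.val_start, WithBot.coe_lt_coe, Nat.cast_lt]
        have := hP.one_le_value
        omega)
      obtain ⟨k, -, he⟩ := exists_nat_eq_of_le (hP.le_val 0 hs i) h1.le
      rw [← he, WithBot.coe_lt_coe, Nat.cast_lt] at h1
      rw [← he, WithBot.coe_le_coe, Nat.cast_le]
      omega
    have : P.val = Q.val := by
      funext i
      rcases Nat.le_total i t with hi | hi
      · exact hval i hi
      · rw [htail P hP i hi, htail Q hQ i hi]
    cases P; cases Q; simpa using this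

theorem exists_pumping_data {P : BicliqueProfile} {s t : ℕ} (hP : Admissible P s t) :
    ∃ (N : ℕ) (α : ℚ) (R : ℕ) (C : ZMod R → PumpingCore) (a : ZMod R → ℚ),
      0 ≤ α ∧ 0 < R ∧
      (∀ j, (C j).size ≤ N) ∧
      IsPumpingFamily P C ∧
      (∀ j, a j ≤ 0) ∧
      (∀ᶠ n : ℕ in atTop, (P.ex n : ℚ) = a (n : ZMod R) + α * n) ∧
      α ≤ (s : ℚ) - 1 + ((t : ℚ) - 1) / 2 ∧
      (2 ≤ s → ∀ n : ℕ, 1 ≤ n →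
        (P.ex n : ℚ) < ((s : ℚ) - 1 + ((t : ℚ) - 1) / 2) * n) ∧
      (2 ≤ s → ∀ (R' : ℕ) (C' : ZMod R' → PumpingCore), 0 < R' → IsPumpingFamily P C' →
        (∃ q, (C' q).IsConnectedComponent) →
          α < (s : ℚ) - 1 + ((t : ℚ) - 1) / 2) := by
  obtain ⟨p, h, D, hS⟩ := exists_hasSlope hP
  obtain ⟨N, R, C, δ, hR, hN, hC, hδ⟩ := hS.exists_pumpingFamily hP
  have hh : (0 : ℚ) < h := by exact_mod_cast hS.pos
  have hs := hP.one_le_start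
  have ht := hP.one_le_value
  have hcast : ((2 * s + t - 3 : ℕ) : ℚ) = 2 * s + t - 3 := by
    rw [Nat.cast_sub (by omega)]
    push_cast
    ring
  refine ⟨N, p / (2 * h), R, C, fun j => -(δ j / (2 * h)), by positivity, hR, hN, hC,
    fun j => neg_nonpos.2 (by positivity), ?_, ?_, ?_, ?_⟩
  · filter_upwards [hδ] with n hn
    have hn' : (h : ℚ) * (2 * P.ex n) + δ n = p * n := by exact_mod_cast hn
    field_simp
    linarith
  · have h1 : (p : ℚ) ≤ h * (2 * s + t - 3) := by
      rw [← hcast]; exact_mod_cast hS.le hP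
    rw [div_le_iff₀ (by positivity)]
    linarith
  · intro hs2 n hn
    have h1 := two_mul_ex_le hP n
    rw [if_pos ⟨hs2, hn⟩] at h1
    have h2 : 2 * (P.ex n : ℚ) + 1 ≤ (2 * s + t - 3) * n := by
      rw [← hcast]; exact_mod_cast h1
    linarith
  · rintro hs2 R' C' hR' hC' ⟨q, hq⟩
    have h1 : (p : ℚ) < h * (2 * s + t - 3) := by
      rw [← hcast]; exact_mod_cast hS.lt_of_isConnectedComponent hP hs2 hR' hC' hq
    rw [div_lt_iff₀ (by positivity)]
    linarith

theorem mainTheorem2 (s t : ℕ) (hs : 1 ≤ s) (ht : 1 ≤ t) :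
    ∃ N : ℕ, ∀ P : BicliqueProfile,
      P.IsStartIndex s → P.val s = (((t - 1 : ℕ) : ℕ∞) : WithBot ℕ∞) → 0 ≤ P.limit →
      ∃ (α : ℚ) (R : ℕ) (C : ZMod R → PumpingCore) (a : ZMod R → ℚ),
        0 ≤ α ∧ 0 < R ∧
        (∀ j, (C j).size ≤ N) ∧
        IsPumpingFamily P C ∧
        (∀ j, a j ≤ 0) ∧
        (∀ᶠ n : ℕ in atTop, (P.ex n : ℚ) = a (n : ZMod R) + α * n) ∧
        α ≤ (s : ℚ) - 1 + ((t : ℚ) - 1) / 2 ∧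
        (2 ≤ s → ∀ n : ℕ, 1 ≤ n →
          (P.ex n : ℚ) < ((s : ℚ) - 1 + ((t : ℚ) - 1) / 2) * n) ∧
        (2 ≤ s → ∀ (R' : ℕ) (C' : ZMod R' → PumpingCore), 0 < R' → IsPumpingFamily P C' →
          (∃ q, (C' q).IsConnectedComponent) →
            α < (s : ℚ) - 1 + ((t : ℚ) - 1) / 2) := by
  choose! N hN using fun (P : BicliqueProfile) (hP : Admissible P s t) => exists_pumping_data hP
  -- The maximum over the finitely many profiles makes the bound depend on `s` and `t` only.
  refine ⟨(finite_admissible s t).toFinset.sup N, fun P hstart hval _ => ?_⟩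
  have hP := admissible_of_isStartIndex hs ht hstart hval
  obtain ⟨α, R, C, a, h1, h2, h3, h4⟩ := hN P hP
  exact ⟨α, R, C, a, h1, h2, fun j => (h3 j).trans (Finset.le_sup (by simpa using hP)), h4⟩
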